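/- Let $(X,d)$ be a complete metric space with at least two points, equipped with a Borel regular (outer) measure $\mu$ that is doubling, i.e. $0<\mu(B(x,2r))\le C_d\,\mu(B(x,r))<\infty$ for all balls, and that supports a $(1,1)$-Poincaré inequality: there are $C_P>0$, $\lambda\ge 1$ such that $\frac{1}{\mu(B(x,r))}\int_{B(x,r)}|u-u_{B(x,r)}|\,d\mu\le C_P\, r\,\frac{1}{\mu(B(x,\lambda r))}\int_{B(x,\lambda r)}g\,d\mu$ for every ball, every locally integrable $u$ (with mean value $u_{B(x,r)}$ over the ball) and every upper gradient $g$ of $u$. For an open set $U\subset X$ let $$\|Du\|(U):=\inf\Big\{\liminf_{i\to\infty}\int_U g_{u_i}\,d\mu:\ u_i\in \mathrm{Lip}_{\mathrm{loc}}(U),\ u_i\to u\text{ in }L^1_{\mathrm{loc}}(U)\Big\},$$ where $g_{u_i}$ is the minimal $1$-weak upper gradient of $u_i$ in $U$; let $\mathrm{BV}(U)$ be the space of $u\in L^1(U)$ with $\|Du\|(U)<\infty$, with norm $\|u\|_{\mathrm{BV}(U)}=\|u\|_{L^1(U)}+\|Du\|(U)$. Let $\mathcal H$ be the codimension $1$ Hausdorff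 measure, $\mathcal H(A)=\lim_{R\to0}\inf\{\sum_i \mu(B(x_i,r_i))/r_i:\ A\subset\bigcup_i B(x_i,r_i),\ r_i\le R\}$ (countable coverings). For an open set $\Omega\subset X$ and a function $u$ on $\Omega$, the interior trace $T_+u$ is the function on $\partial\Omega$ such that for $\mathcal H$-a.e. $x\in\partial\Omega$ $$\lim_{r\to0^+}\frac1{\mu(\Omega\cap B(x,r))}\int_{\Omega\cap B(x,r)}|u-T_+u(x)|\,d\mu=0,$$ if such a function exists. Let $\Omega\subset X$ be an open set such that the trace operator $T_+\colon\mathrm{BV}(\Omega)\to L^1(\partial\Omega,\mathcal H)$ is (well defined,) linear and bounded; that is, the trace $T_+u$ of each $u\in\mathrm{BV}(\Omega)$ exists and lies in $L^1(\partial\Omega,\mathcal H)$, $T_+u$ depends linearly on $u$, and $\int_{\partial\Omega}|T_+u|\,d\mathcal H\le C\|u\|_{\mathrm{BV}(\Omega)}$ for a constant $C$ independent of $u$. Let $u\in\mathrm{BV}(\Omega)$ and $u_k\in\mathrm{BV}(\Omega)$, $k\in\mathbb N$, be such that $$u_k\to u\ \text{ in }L^1(\Omega)\qquad\text{and}\qquad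 \|Du_k\|(\Omega)\to\|Du\|(\Omega).$$ Then $T_+u_k\to T_+u$ in $L^1(\partial\Omega,\mathcal H)$. -/

import Mathlib

open MeasureTheory Filter Topology Set
open scoped ENNReal NNReal

namespace BVTrace

/-! ### Curves and upper gradients -/

/-- A curve: a rectifiable continuous map from a compact interval `[a, b]` into `X`
(the values of `toFun` outside `[a, b]` play no role). -/
structure Curve (X : Type*) [MetricSpace X] where
  a : ℝ
  b : ℝ
  a_le_b : a ≤ b
  toFun : ℝ → X
  continuousOn : ContinuousOn toFun (Icc a b)
  rectifiable : eVariationOn toFun (Icc a b) ≠ ∞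

section Curves

variable {X : Type*} [MetricSpace X]

/-- The length of a curve. -/
noncomputable def Curve.length (γ : Curve X) : ℝ :=
  (eVariationOn γ.toFun (Icc γ.a γ.b)).toReal

/-- The arc-length parametrization of a curve, on the interval `[0, length]`. -/
noncomputable def Curve.arcLength (γ : Curve X) : ℝ → X :=
  naturalParameterization γ.toFun (Icc γ.a γ.b) γ.a

/-- The line integral `∫_γ g ds` of a nonnegative function. -/
noncomputable def Curve.lineIntegral (γ : Curve X) (g : X → ℝ≥0∞) : ℝ≥0∞ :=
  ∫⁻ s in Icc 0 γ.length, g (γ.arcLength s)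

/-- The curve lies in the set `U`. -/
def Curve.LiesIn (γ : Curve X) (U : Set X) : Prop :=
  ∀ t ∈ Icc γ.a γ.b, γ.toFun t ∈ U

/-- The upper gradient inequality `|u(x) - u(y)| ≤ ∫_γ g ds`, where `x` and `y` are the
end points of `γ`. -/
def UpperGradientIneq (u : X → ℝ) (g : X → ℝ≥0∞) (γ : Curve X) : Prop :=
  ENNReal.ofReal |u (γ.toFun γ.a) - u (γ.toFun γ.b)| ≤ γ.lineIntegral g

/-- `g` is an upper gradient of `u` on the whole space. -/
def IsUpperGradient [MeasurableSpace X] (u : X → ℝ) (g : X → ℝ≥0∞) : Prop :=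
  Measurable g ∧ ∀ γ : Curve X, UpperGradientIneq u g γ

/-- The `1`-modulus of a family of curves. -/
noncomputable def modulusOne [MeasurableSpace X] (μ : Measure X) (Γ : Set (Curve X)) : ℝ≥0∞ :=
  ⨅ (ρ : X → ℝ≥0∞) (_ : Measurable ρ) (_ : ∀ γ ∈ Γ, 1 ≤ γ.lineIntegral ρ), ∫⁻ x, ρ x ∂μ

/-- `g` is a `1`-weak upper gradient of `u` in `U`: a nonnegative `μ`-measurable function
such that the upper gradient inequality holds for `1`-almost every curve in `U`. -/
def IsWeakUpperGradient [MeasurableSpace X] (μ : Measure X) (u : X → ℝ) (g : X → ℝ≥0∞)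
    (U : Set X) : Prop :=
  AEMeasurable g (μ.restrict U) ∧
    modulusOne μ {γ : Curve X | γ.LiesIn U ∧ ¬ UpperGradientIneq u g γ} = 0

/-- The integral `∫_U g_u dμ` of the minimal `1`-weak upper gradient `g_u` of `u` in `U`: the least
integral of a `1`-weak upper gradient, which is the one of `g_u` because `g_u ≤ g` almost everywhere
in `U` for each locally integrable `1`-weak upper gradient `g` of `u` in `U`. The value is `∞` if
`u` has no integrable `1`-weak upper gradient in `U`. -/
noncomputable def gradientIntegral [MeasurableSpace X] (μ : Measure X) (u : X → ℝ) (U : Set X) :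
    ℝ≥0∞ :=
  ⨅ (g : X → ℝ≥0∞) (_ : IsWeakUpperGradient μ u g U), ∫⁻ x in U, g x ∂μ

end Curves

/-! ### Standing assumptions on the space -/

/-- `μ` is doubling: `0 < μ(B(x,2r)) ≤ C μ(B(x,r)) < ∞` for all balls, with a constant `C`. -/
def IsDoubling {X : Type*} [MetricSpace X] [MeasurableSpace X] (μ : Measure X) : Prop :=
  ∃ C : ℝ≥0, 1 ≤ C ∧ ∀ (x : X) (r : ℝ), 0 < r →
    0 < μ (Metric.ball x (2 * r)) ∧
    μ (Metric.ball x (2 * r)) ≤ C * μ (Metric.ball x r) ∧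
    μ (Metric.ball x r) < ∞

/-- The space supports a `(1,1)`-Poincaré inequality. -/
def SupportsPoincare {X : Type*} [MetricSpace X] [MeasurableSpace X] (μ : Measure X) : Prop :=
  ∃ C lam : ℝ, 0 < C ∧ 1 ≤ lam ∧
    ∀ (x : X) (r : ℝ), 0 < r → ∀ u : X → ℝ, LocallyIntegrable u μ →
      ∀ g : X → ℝ≥0∞, IsUpperGradient u g →
        (⨍⁻ y in Metric.ball x r, ‖u y - ⨍ z in Metric.ball x r, u z ∂μ‖ₑ ∂μ) ≤
          ENNReal.ofReal (C * r) * ⨍⁻ y in Metric.ball x (lam * r), g y ∂μ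

/-! ### Functions of bounded variation -/

section BV

variable {X : Type*} [MetricSpace X]

/-- `V ⋐ U`: the set `V` is open and its closure is a compact subset of `U`. -/
def CompactlyInside (V U : Set X) : Prop :=
  IsOpen V ∧ IsCompact (closure V) ∧ closure V ⊆ U

/-- `v ∈ Lip_loc(U)`: `v` is Lipschitz in every `V ⋐ U`. -/
def IsLipLoc (v : X → ℝ) (U : Set X) : Prop :=
  ∀ V : Set X, CompactlyInside V U → ∃ K : ℝ≥0, LipschitzOnWith K v V

variable [MeasurableSpace X]

/-- `v i → u` in `L¹_loc(U)`. -/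
def TendstoL1Loc (μ : Measure X) (v : ℕ → X → ℝ) (u : X → ℝ) (U : Set X) : Prop :=
  ∀ V : Set X, CompactlyInside V U →
    Tendsto (fun i => ∫⁻ x in V, ‖v i x - u x‖ₑ ∂μ) atTop (𝓝 0)

/-- The total variation `‖Du‖(U)` of `u` in the open set `U`. -/
noncomputable def totalVariation (μ : Measure X) (u : X → ℝ) (U : Set X) : ℝ≥0∞ :=
  ⨅ (v : ℕ → X → ℝ) (_ : ∀ i, IsLipLoc (v i) U) (_ : TendstoL1Loc μ v u U),
    liminf (fun i => gradientIntegral μ (v i) U) atTop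

/-- `u ∈ BV(U)`. Functions are given on all of `X`, only their values in `U` matter. -/
def IsBV (μ : Measure X) (u : X → ℝ) (U : Set X) : Prop :=
  IntegrableOn u U μ ∧ totalVariation μ u U < ∞

/-- The norm `‖u‖_{BV(U)} = ‖u‖_{L¹(U)} + ‖Du‖(U)`. -/
noncomputable def bvNorm (μ : Measure X) (u : X → ℝ) (U : Set X) : ℝ≥0∞ :=
  (∫⁻ x in U, ‖u x‖ₑ ∂μ) + totalVariation μ u U

end BV

/-! ### The codimension one Hausdorff measure -/

section Hausdorff

variable {X : Type*} [MetricSpace X] [MeasurableSpace X]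

/-- The weight of a set in a covering by balls of radius at most `R`: it is `μ(B(x,r)) / r` if the
set is a ball `B(x,r)` with `0 < r ≤ R` (the infimum over all such centres and radii), and `∞` if it
is not such a ball. -/
noncomputable def ballWeight (μ : Measure X) (R : ℝ) (s : Set X) : ℝ≥0∞ :=
  ⨅ (x : X) (r : ℝ) (_ : 0 < r ∧ r ≤ R ∧ s = Metric.ball x r),
    μ (Metric.ball x r) / ENNReal.ofReal r

/-- The restricted spherical Hausdorff content `H_R` of codimension one: the infimum of
`∑ μ(B(x_i,r_i)) / r_i` over all countable coverings by balls with radii at most `R`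
(`boundedBy` lets some members of the covering be empty, with weight `0`). -/
noncomputable def hausdorffContent (μ : Measure X) (R : ℝ) : OuterMeasure X :=
  OuterMeasure.boundedBy (ballWeight μ R)

/-- The limit of the contents `H_R` as `R → 0`, which is their supremum. -/
noncomputable def hausdorffOuter (μ : Measure X) : OuterMeasure X :=
  ⨆ (R : ℝ) (_ : 0 < R), hausdorffContent μ R

theorem hausdorffContent_anti (μ : Measure X) {R S : ℝ} (h : R ≤ S) :
    hausdorffContent μ S ≤ hausdorffContent μ R := by
  refine OuterMeasure.le_boundedBy.2 fun s => (OuterMeasure.boundedBy_le s).trans ?_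
  refine le_iInf fun x => le_iInf fun r => le_iInf fun hr => ?_
  exact iInf_le_of_le x (iInf_le_of_le r (iInf_le_of_le ⟨hr.1, hr.2.1.trans h, hr.2.2⟩ le_rfl))

theorem hausdorffOuter_isMetric (μ : Measure X) : (hausdorffOuter μ).IsMetric := by
  rintro s t ⟨d, d0, hd⟩
  refine le_antisymm (measure_union_le _ _) ?_
  have key : ∀ R : ℝ, 0 < R → ENNReal.ofReal (2 * R) < d →
      hausdorffContent μ R s + hausdorffContent μ R t ≤ hausdorffOuter μ (s ∪ t) := by
    intro R hR hRd
    have h1 : hausdorffContent μ R (s ∪ t) =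
        hausdorffContent μ R s + hausdorffContent μ R t := by
      refine OuterMeasure.boundedBy_union_of_top_of_nonempty_inter ?_
      rintro u ⟨x, hxs, hxu⟩ ⟨y, hyt, hyu⟩
      refine top_unique (le_iInf fun z => le_iInf fun r => le_iInf fun hr => ?_)
      exfalso
      obtain ⟨-, hrR, rfl⟩ := hr
      refine absurd (hd x hxs y hyt) (not_le.2 (lt_of_le_of_lt ?_ hRd))
      rw [edist_dist]
      refine ENNReal.ofReal_le_ofReal ?_
      have h2 := dist_triangle_right x y z
      rw [Metric.mem_ball] at hxu hyu
      linarith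
    rw [← h1]
    have h3 : hausdorffContent μ R ≤ hausdorffOuter μ :=
      le_iSup₂ (f := fun (R : ℝ) (_ : 0 < R) => hausdorffContent μ R) R hR
    exact h3 _
  obtain ⟨R₀, hR₀, hR₀d⟩ : ∃ R : ℝ, 0 < R ∧ ENNReal.ofReal (2 * R) < d := by
    obtain ⟨e, he0, hed⟩ := ENNReal.lt_iff_exists_nnreal_btwn.1 (pos_iff_ne_zero.2 d0)
    refine ⟨e / 2, by have : (0 : ℝ≥0) < e := by exact_mod_cast he0
                      positivity, ?_⟩
    rw [mul_div_cancel₀ (e : ℝ) two_ne_zero, ENNReal.ofReal_coe_nnreal]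
    exact hed
  have happ : ∀ w : Set X, hausdorffOuter μ w = ⨆ R : {R : ℝ // 0 < R}, hausdorffContent μ R w := by
    intro w
    simp only [hausdorffOuter, OuterMeasure.iSup_apply, iSup_subtype]
  rw [happ s, happ t]
  refine ENNReal.iSup_add_iSup_le fun R S => ?_
  have hpos : 0 < min R₀ (min R.1 S.1) := lt_min hR₀ (lt_min R.2 S.2)
  refine le_trans (add_le_add (hausdorffContent_anti μ ?_ s) (hausdorffContent_anti μ ?_ t))
    (key _ hpos (lt_of_le_of_lt (ENNReal.ofReal_le_ofReal ?_) hR₀d))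
  · exact (min_le_right _ _).trans (min_le_left _ _)
  · exact (min_le_right _ _).trans (min_le_right _ _)
  · have := min_le_left R₀ (min R.1 S.1)
    linarith

/-- The codimension one Hausdorff measure `H`, as a Borel measure. -/
noncomputable def hausdorffCodimOne [BorelSpace X] (μ : Measure X) : Measure X :=
  (hausdorffOuter μ).toMeasure (hausdorffOuter_isMetric μ).le_caratheodory

end Hausdorff

/-! ### Interior traces -/

section Trace

variable {X : Type*} [MetricSpace X] [MeasurableSpace X]

/-- The number `t` is the interior trace of `u` at the boundary point `x` of the open set `Ω`:
the mean value of `|u - t|` over `Ω ∩ B(x,r)` tends to `0` as `r → 0+`. (For open `Ω` and `μ`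
positive on balls, `Ω ∩ B(x,r)` has positive measure and `t` is unique.) -/
def HasInteriorTraceAt (μ : Measure X) (Ω : Set X) (u : X → ℝ) (x : X) (t : ℝ) : Prop :=
  Tendsto (fun r : ℝ => ⨍⁻ y in Ω ∩ Metric.ball x r, ‖u y - t‖ₑ ∂μ) (𝓝[>] 0) (𝓝 0)

/-- The interior trace `T₊u`: at each point `x` where it exists, `interiorTrace μ Ω u x` is the
number `t` with `HasInteriorTraceAt μ Ω u x t`; elsewhere the value is arbitrary. -/
noncomputable def interiorTrace (μ : Measure X) (Ω : Set X) (u : X → ℝ) (x : X) : ℝ :=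
  Classical.epsilon fun t : ℝ => HasInteriorTraceAt μ Ω u x t

/-- `T₊ : BV(Ω) → L¹(∂Ω, H)` is a (well defined) linear and bounded operator. -/
structure TraceOperatorIsLinearBounded [BorelSpace X] (μ : Measure X) (Ω : Set X) : Prop where
  /-- The interior trace of every `BV` function exists at almost every boundary point. -/
  exists_trace : ∀ u : X → ℝ, IsBV μ u Ω →
    ∀ᵐ x ∂(hausdorffCodimOne μ).restrict (frontier Ω), ∃ t : ℝ, HasInteriorTraceAt μ Ω u x t
  /-- The trace is in `L¹(∂Ω, H)`. -/
  integrable : ∀ u : X → ℝ, IsBV μ u Ω →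
    IntegrableOn (interiorTrace μ Ω u) (frontier Ω) (hausdorffCodimOne μ)
  /-- The trace operator is linear. -/
  linear : ∀ u v : X → ℝ, IsBV μ u Ω → IsBV μ v Ω → ∀ a b : ℝ,
    interiorTrace μ Ω (fun x => a * u x + b * v x)
      =ᵐ[(hausdorffCodimOne μ).restrict (frontier Ω)]
        fun x => a * interiorTrace μ Ω u x + b * interiorTrace μ Ω v x
  /-- The trace operator is bounded. -/
  bounded : ∃ C : ℝ≥0, ∀ u : X → ℝ, IsBV μ u Ω →
    ∫⁻ x in frontier Ω, ‖interiorTrace μ Ω u x‖ₑ ∂hausdorffCodimOne μ ≤ C * bvNorm μ u Ω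

end Trace

end BVTrace

namespace BVTrace

/-! ### Arc length parametrizations -/

/-! Put w = v k - u; by linearity, the trace of w must tend to 0 in L¹. The trace sees only values
near the boundary, so w may be multiplied by a cutoff that is 1 where `depth` ≤ c/4 and 0 where
`depth` ≥ c/2. Boundedness of the trace operator then yields `lintegral_trace_le`: up to a constant,
the trace is bounded by (1 + 4/c) times the L¹ norm of w plus the variation of w in the layer {0 <
depth < c}. For fixed c the first term tends to 0. The second is at most the variation of v k plus
that of u in the layer, and `eventually_totalVariation_shell_le` makes both small: almost all
variation of u lies in {depth > c}, by lower semicontinuity v k has nearly as much there for large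
k, and as the total variations converge, little is left for the layer.

This uses superadditivity of the variation on disjoint open sets, subadditivity in the function,
lower semicontinuity, and inner regularity (`exists_totalVariation_le_add`). Inner regularity is the
hard part and is proved without knowing that the variation is a measure. Ω is covered by overlapping
dyadic shells of `depth`, and u is approximated in each shell so well in L¹ that joining consecutive
approximants costs arbitrarily little. Hence the variation in Ω is at most the sum of the variations
in the shells (`totalVariation_le_tsum`). By superadditivity that sum has a convergent tail, which
can be dropped.

Cutoff and joining both rest on `gradientIntegral_glued_le`: if a function is locally φ v m + (1 -
φ) v n, a weak upper gradient is the supremum of those of the v n plus a bound for Lip(φ) |v m - v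
n|. The inequality is verified on short subcurves in arc length and then summed. Doubling and
completeness enter through properness, which makes the superlevel sets of `depth` compact. -/

theorem continuousOn_variationOnFromTo {X : Type*} [PseudoMetricSpace X] {f : ℝ → X} {s : Set ℝ}
    {a : ℝ} (ha : a ∈ s) (hf : ContinuousOn f s) (hv : LocallyBoundedVariationOn f s) :
    ContinuousOn (variationOnFromTo f s a) s := by
  intro b hb
  have hl := variationOnFromTo.tendsto_left ha hb hv
    ((hf b hb).mono_left (nhdsWithin_mono _ (inter_subset_left (t := Iio b))))
  have hr := variationOnFromTo.tendsto_right ha hb hv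
    ((hf b hb).mono_left (nhdsWithin_mono _ (inter_subset_left (t := Ioi b))))
  -- The one-sided jumps of the variation function are the jumps of `f`, which vanish by continuity.
  rw [dist_self, sub_zero] at hl
  rw [dist_self, add_zero] at hr
  have h1 : ContinuousWithinAt (variationOnFromTo f s a) (insert b ((s ∩ Iio b) ∪ (s ∩ Ioi b))) b :=
    continuousWithinAt_insert_self.2 (ContinuousWithinAt.union hl hr)
  refine h1.mono fun x hx => ?_
  rcases lt_trichotomy x b with h | h | h
  · exact Or.inr (Or.inl ⟨hx, h⟩)
  · exact Or.inl h
  · exact Or.inr (Or.inr ⟨hx, h⟩)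

namespace Curve

variable {X : Type*} [MetricSpace X] (γ : Curve X)

theorem locallyBoundedVariationOn : LocallyBoundedVariationOn γ.toFun (Icc γ.a γ.b) :=
  BoundedVariationOn.locallyBoundedVariationOn γ.rectifiable

theorem length_nonneg : 0 ≤ γ.length := ENNReal.toReal_nonneg

theorem left_mem : γ.a ∈ Icc γ.a γ.b := left_mem_Icc.2 γ.a_le_b

theorem right_mem : γ.b ∈ Icc γ.a γ.b := right_mem_Icc.2 γ.a_le_b

theorem variationOnFromTo_right :
    variationOnFromTo γ.toFun (Icc γ.a γ.b) γ.a γ.b = γ.length := by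
  rw [variationOnFromTo.eq_of_le _ _ γ.a_le_b, inter_self, length]

theorem image_variationOnFromTo :
    variationOnFromTo γ.toFun (Icc γ.a γ.b) γ.a '' Icc γ.a γ.b = Icc 0 γ.length := by
  have hm := variationOnFromTo.monotoneOn γ.locallyBoundedVariationOn γ.left_mem
  have hc := continuousOn_variationOnFromTo γ.left_mem γ.continuousOn γ.locallyBoundedVariationOn
  refine Subset.antisymm ?_ ?_
  · rintro _ ⟨t, ht, rfl⟩
    refine ⟨variationOnFromTo.nonneg_of_le _ _ ht.1, ?_⟩
    rw [← variationOnFromTo_right]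
    exact hm ht γ.right_mem ht.2
  · have := intermediate_value_Icc γ.a_le_b hc
    rwa [variationOnFromTo.self, variationOnFromTo_right] at this

theorem hasUnitSpeedOn_arcLength : HasUnitSpeedOn γ.arcLength (Icc 0 γ.length) := by
  rw [← image_variationOnFromTo]
  exact has_unit_speed_naturalParameterization _ γ.locallyBoundedVariationOn γ.left_mem

theorem arcLength_variationOnFromTo {t : ℝ} (ht : t ∈ Icc γ.a γ.b) :
    γ.arcLength (variationOnFromTo γ.toFun (Icc γ.a γ.b) γ.a t) = γ.toFun t :=
  edist_eq_zero.1
    (edist_naturalParameterization_eq_zero γ.locallyBoundedVariationOn γ.left_mem ht)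

theorem arcLength_zero : γ.arcLength 0 = γ.toFun γ.a := by
  have := γ.arcLength_variationOnFromTo γ.left_mem
  rwa [variationOnFromTo.self] at this

theorem arcLength_length : γ.arcLength γ.length = γ.toFun γ.b := by
  have := γ.arcLength_variationOnFromTo γ.right_mem
  rwa [variationOnFromTo_right] at this

theorem LiesIn.arcLength_mem {γ : Curve X} {U : Set X} (h : γ.LiesIn U) {s : ℝ}
    (hs : s ∈ Icc 0 γ.length) : γ.arcLength s ∈ U := by
  rw [← image_variationOnFromTo] at hs
  obtain ⟨t, ht, rfl⟩ := hs
  rw [arcLength_variationOnFromTo _ ht]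
  exact h t ht

theorem dist_arcLength_le {s t : ℝ} (hs : s ∈ Icc 0 γ.length) (ht : t ∈ Icc 0 γ.length)
    (hst : s ≤ t) : dist (γ.arcLength s) (γ.arcLength t) ≤ t - s := by
  have h1 := eVariationOn.edist_le γ.arcLength (s := Icc 0 γ.length ∩ Icc s t)
    ⟨hs, left_mem_Icc.2 hst⟩ ⟨ht, right_mem_Icc.2 hst⟩
  rw [γ.hasUnitSpeedOn_arcLength hs ht, edist_dist, NNReal.coe_one, one_mul] at h1
  exact (ENNReal.ofReal_le_ofReal_iff (sub_nonneg.2 hst)).1 h1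

theorem lipschitzOnWith_arcLength : LipschitzOnWith 1 γ.arcLength (Icc 0 γ.length) := by
  refine LipschitzOnWith.of_dist_le_mul fun s hs t ht => ?_
  rw [NNReal.coe_one, one_mul]
  rcases le_total s t with h | h
  · rw [dist_comm s t, Real.dist_eq, abs_of_nonneg (sub_nonneg.2 h)]
    exact γ.dist_arcLength_le hs ht h
  · rw [dist_comm, Real.dist_eq, abs_of_nonneg (sub_nonneg.2 h)]
    exact γ.dist_arcLength_le ht hs h

/-- The part of a curve between the arc length parameters `s` and `t`. -/
noncomputable def sub {s t : ℝ} (hs : 0 ≤ s) (hst : s ≤ t) (ht : t ≤ γ.length) : Curve X where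
  a := s
  b := t
  a_le_b := hst
  toFun := γ.arcLength
  continuousOn := γ.lipschitzOnWith_arcLength.continuousOn.mono (Icc_subset_Icc hs ht)
  rectifiable := by
    have h := γ.hasUnitSpeedOn_arcLength ⟨hs, hst.trans ht⟩ ⟨hs.trans hst, ht⟩
    rw [inter_eq_self_of_subset_right (Icc_subset_Icc hs ht)] at h
    rw [h]
    exact ENNReal.ofReal_ne_top

section sub

variable {s t : ℝ} (hs : 0 ≤ s) (hst : s ≤ t) (ht : t ≤ γ.length)

theorem eVariationOn_arcLength {s t : ℝ} (hs : 0 ≤ s) (hst : s ≤ t) (ht : t ≤ γ.length) :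
    eVariationOn γ.arcLength (Icc s t) = ENNReal.ofReal (t - s) := by
  have h := γ.hasUnitSpeedOn_arcLength ⟨hs, hst.trans ht⟩ ⟨hs.trans hst, ht⟩
  rwa [inter_eq_self_of_subset_right (Icc_subset_Icc hs ht), NNReal.coe_one, one_mul] at h

theorem length_sub : (γ.sub hs hst ht).length = t - s := by
  show (eVariationOn γ.arcLength (Icc s t)).toReal = t - s
  rw [γ.eVariationOn_arcLength hs hst ht, ENNReal.toReal_ofReal (sub_nonneg.2 hst)]

theorem arcLength_sub {r : ℝ} (hr : r ∈ Icc s t) :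
    (γ.sub hs hst ht).arcLength (r - s) = γ.arcLength r := by
  have h := (γ.sub hs hst ht).arcLength_variationOnFromTo (t := r) hr
  have h2 : variationOnFromTo (γ.sub hs hst ht).toFun
      (Icc (γ.sub hs hst ht).a (γ.sub hs hst ht).b) (γ.sub hs hst ht).a r = r - s := by
    show variationOnFromTo γ.arcLength (Icc s t) s r = r - s
    rw [variationOnFromTo.eq_of_le _ _ hr.1,
      inter_eq_self_of_subset_right (Icc_subset_Icc_right hr.2),
      γ.eVariationOn_arcLength hs hr.1 (hr.2.trans ht), ENNReal.toReal_ofReal (sub_nonneg.2 hr.1)]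
  rw [h2] at h
  exact h

theorem lineIntegral_sub (g : X → ℝ≥0∞) :
    (γ.sub hs hst ht).lineIntegral g = ∫⁻ r in Icc s t, g (γ.arcLength r) := by
  have h1 := (measurePreserving_sub_right (volume : Measure ℝ) s).setLIntegral_comp_preimage_emb
    (Homeomorph.subRight s).measurableEmbedding
    (fun r => g ((γ.sub hs hst ht).arcLength r)) (Icc 0 (t - s))
  rw [lineIntegral, length_sub, ← h1]
  have h2 : (fun x => x - s) ⁻¹' Icc 0 (t - s) = Icc s t := by
    ext x; simp
  rw [h2]
  refine setLIntegral_congr_fun measurableSet_Icc fun r hr => ?_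
  simp only [γ.arcLength_sub hs hst ht hr]

end sub

end Curve

/-! ### Modulus of curve families -/

section Modulus

variable {X : Type*} [MetricSpace X] [MeasurableSpace X] {μ : Measure X}

theorem modulusOne_mono {Γ Γ' : Set (Curve X)} (h : Γ ⊆ Γ') : modulusOne μ Γ ≤ modulusOne μ Γ' :=
  le_iInf fun ρ => le_iInf fun hρ => le_iInf fun hΓ =>
    iInf_le_of_le ρ (iInf_le_of_le hρ (iInf_le_of_le (fun γ hγ => hΓ γ (h hγ)) le_rfl))

theorem modulusOne_lt_iff {Γ : Set (Curve X)} {c : ℝ≥0∞} :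
    modulusOne μ Γ < c ↔ ∃ ρ : X → ℝ≥0∞, Measurable ρ ∧ (∀ γ ∈ Γ, 1 ≤ γ.lineIntegral ρ) ∧
      ∫⁻ x, ρ x ∂μ < c := by
  simp only [modulusOne, iInf_lt_iff, exists_prop]

/-- Admissible densities with summable, arbitrarily small integrals add up to a density admissible
for the union. -/
theorem modulusOne_iUnion_eq_zero {Γ : ℕ → Set (Curve X)} (h : ∀ n, modulusOne μ (Γ n) = 0) :
    modulusOne μ (⋃ n, Γ n) = 0 := by
  refine le_antisymm (ENNReal.le_of_forall_pos_le_add fun ε hε _ => ?_) zero_le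
  obtain ⟨δ, hδ, hsum⟩ := ENNReal.exists_pos_sum_of_countable
    (ENNReal.coe_ne_zero.2 hε.ne') ℕ
  have h1 : ∀ n, ∃ ρ : X → ℝ≥0∞, Measurable ρ ∧ (∀ γ ∈ Γ n, 1 ≤ γ.lineIntegral ρ) ∧
      ∫⁻ x, ρ x ∂μ < δ n := fun n => modulusOne_lt_iff.1 (by rw [h n]; exact_mod_cast hδ n)
  choose ρ hρ hΓ hint using h1
  rw [zero_add]
  refine le_trans (iInf_le_of_le (fun x => ∑' n, ρ n x)
    (iInf_le_of_le (Measurable.tsum hρ) (iInf_le_of_le ?_ le_rfl))) ?_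
  · intro γ hγ
    obtain ⟨n, hn⟩ := mem_iUnion.1 hγ
    exact (hΓ n γ hn).trans (lintegral_mono fun s => ENNReal.le_tsum n)
  · rw [lintegral_tsum fun n => (hρ n).aemeasurable]
    exact (ENNReal.tsum_le_tsum fun n => (hint n).le).trans hsum.le

/-- A line integral over a subcurve is at most that over the whole curve, so any density admissible
for `Γ` is admissible for `Γ'`. -/
theorem modulusOne_subcurve_eq_zero {Γ Γ' : Set (Curve X)} (h : modulusOne μ Γ = 0)
    (hsub : ∀ γ ∈ Γ', ∃ (s t : ℝ) (hs : 0 ≤ s) (hst : s ≤ t) (ht : t ≤ γ.length),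
      γ.sub hs hst ht ∈ Γ) : modulusOne μ Γ' = 0 := by
  refine le_antisymm (le_trans ?_ h.le) zero_le
  refine le_iInf fun ρ => le_iInf fun hρ => le_iInf fun hΓ =>
    iInf_le_of_le ρ (iInf_le_of_le hρ (iInf_le_of_le (fun γ hγ => ?_) le_rfl))
  obtain ⟨s, t, hs, hst, ht, hmem⟩ := hsub γ hγ
  refine (hΓ _ hmem).trans ?_
  rw [Curve.lineIntegral_sub]
  exact lintegral_mono_set (Icc_subset_Icc hs ht)

end Modulus

/-! ### Gluing of weak upper gradients -/

theorem setLIntegral_Icc_add_Icc (h : ℝ → ℝ≥0∞) {r s t : ℝ} (hrs : r ≤ s) (hst : s ≤ t) :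
    (∫⁻ x in Icc r s, h x) + ∫⁻ x in Icc s t, h x = ∫⁻ x in Icc r t, h x := by
  rw [← setLIntegral_congr (Ioc_ae_eq_Icc (a := r) (b := s)),
    ← setLIntegral_congr (Ioc_ae_eq_Icc (a := s) (b := t)),
    ← setLIntegral_congr (Ioc_ae_eq_Icc (a := r) (b := t)), ← Ioc_union_Ioc_eq_Ioc hrs hst,
    lintegral_union measurableSet_Ioc]
  exact disjoint_left.2 fun x hx hx' => not_lt.2 hx.2 hx'.1

/-- An increment estimate on intervals that holds locally, up to an arbitrarily small multiple of
the length of the interval, holds globally. -/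
theorem ofReal_abs_sub_le_of_locally {F : ℝ → ℝ} {h : ℝ → ℝ≥0∞} {l : ℝ} (hl : 0 ≤ l)
    (hloc : ∀ ε : ℝ, 0 < ε → ∀ p ∈ Icc 0 l, ∃ δ > 0, ∀ s ∈ Icc 0 l, ∀ t ∈ Icc 0 l, s ≤ t →
      s ∈ Metric.ball p δ → t ∈ Metric.ball p δ →
      ENNReal.ofReal |F s - F t| ≤ (∫⁻ x in Icc s t, h x) + ENNReal.ofReal (ε * (t - s))) :
    ENNReal.ofReal |F 0 - F l| ≤ ∫⁻ x in Icc 0 l, h x := by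
  have key : ∀ ε : ℝ, 0 < ε →
      ENNReal.ofReal |F 0 - F l| ≤ (∫⁻ x in Icc 0 l, h x) + ENNReal.ofReal (ε * l) := by
    intro ε hε
    choose! δ hδ H using hloc ε hε
    obtain ⟨t, ht0, hmono, ⟨m, hm⟩, hsub⟩ := exists_monotone_Icc_subset_open_cover_Icc hl
      (c := fun p : Icc 0 l => Subtype.val ⁻¹' Metric.ball (p : ℝ) (δ p))
      (fun p => Metric.isOpen_ball.preimage continuous_subtype_val)
      (fun p _ => mem_iUnion.2 ⟨p, Metric.mem_ball_self (hδ p p.2)⟩)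
    have hn : ∀ n, ENNReal.ofReal |F 0 - F (t n)| ≤
        (∫⁻ x in Icc 0 (t n : ℝ), h x) + ENNReal.ofReal (ε * (t n : ℝ)) := by
      intro n
      induction n with
      | zero => simp [ht0]
      | succ n ih =>
        have hle : (t n : ℝ) ≤ t (n + 1) := hmono n.le_succ
        obtain ⟨p, hp⟩ := hsub n
        have h1 := H p p.2 (t n) (t n).2 (t (n + 1)) (t (n + 1)).2 hle
          (hp (left_mem_Icc.2 (hmono n.le_succ))) (hp (right_mem_Icc.2 (hmono n.le_succ)))
        calc ENNReal.ofReal |F 0 - F (t (n + 1))|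
            ≤ ENNReal.ofReal (|F 0 - F (t n)| + |F (t n) - F (t (n + 1))|) :=
              ENNReal.ofReal_le_ofReal (abs_sub_le _ _ _)
          _ = ENNReal.ofReal |F 0 - F (t n)| + ENNReal.ofReal |F (t n) - F (t (n + 1))| :=
              ENNReal.ofReal_add (abs_nonneg _) (abs_nonneg _)
          _ ≤ _ := add_le_add ih h1
          _ = ((∫⁻ x in Icc 0 (t n : ℝ), h x) + ∫⁻ x in Icc (t n : ℝ) (t (n + 1)), h x) +
              (ENNReal.ofReal (ε * (t n : ℝ)) + ENNReal.ofReal (ε * (t (n + 1) - t n))) :=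
              add_add_add_comm _ _ _ _
          _ = _ := by
              rw [setLIntegral_Icc_add_Icc h (t n).2.1 hle, ← ENNReal.ofReal_add
                (mul_nonneg hε.le (t n).2.1) (mul_nonneg hε.le (sub_nonneg.2 hle))]
              congr 2
              ring
    have := hn m
    rwa [hm m le_rfl] at this
  refine ENNReal.le_of_forall_pos_le_add fun η hη _ => ?_
  -- The denominator `l + 1` keeps the total error below `η` and also covers `l = 0`.
  refine (key (η / (l + 1)) (by positivity)).trans (add_le_add le_rfl ?_)
  rw [← ENNReal.ofReal_coe_nnreal]
  refine ENNReal.ofReal_le_ofReal ?_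
  rw [div_mul_eq_mul_div, div_le_iff₀ (by positivity)]
  nlinarith [η.2, (η.coe_nonneg)]

section Gluing

variable {X : Type*} [MetricSpace X]

/-- Near the point `x`, the function `w` is a convex combination of two members `v m`, `v n` of a
family of functions, with a Lipschitz weight whose Lipschitz constant times `|v m - v n|` is at
most `H`. -/
def LocallyGlued (S : ℕ → Set X) (v : ℕ → X → ℝ) (w : X → ℝ) (H : X → ℝ≥0∞) (x : X) : Prop :=
  ∃ N ∈ 𝓝 x, ∃ m n : ℕ, N ⊆ S m ∩ S n ∧ ∃ (φ : X → ℝ) (K : ℝ≥0), LipschitzOnWith K φ N ∧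
    (∀ y ∈ N, φ y ∈ Icc (0 : ℝ) 1) ∧ (∀ y ∈ N, w y = φ y * v m y + (1 - φ y) * v n y) ∧
    ∀ y ∈ N, ENNReal.ofReal (K * |v m y - v n y|) ≤ H y

/-- The gradient of glued functions. -/
noncomputable def gluedGradient (S : ℕ → Set X) (g : ℕ → X → ℝ≥0∞) (H : X → ℝ≥0∞) (x : X) : ℝ≥0∞ :=
  (⨆ n, (S n).indicator (g n) x) + H x

variable {S : ℕ → Set X} {v : ℕ → X → ℝ} {w : X → ℝ} {g : ℕ → X → ℝ≥0∞} {H : X → ℝ≥0∞}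

/-- A product rule: the weight multiplies the increments of the two functions, and the increment of
the weight multiplies the difference of the two functions at one end only. -/
theorem abs_convexCombination_sub_le {a a' b b' p p' : ℝ} (hp : p ∈ Icc (0 : ℝ) 1) :
    |p * a + (1 - p) * b - (p' * a' + (1 - p') * b')| ≤
      max |a - a'| |b - b'| + |p - p'| * |a' - b'| := by
  have e : p * a + (1 - p) * b - (p' * a' + (1 - p') * b') =
      (p * (a - a') + (1 - p) * (b - b')) + (p - p') * (a' - b') := by ring
  rw [e]
  refine (abs_add_le _ _).trans (add_le_add ?_ (abs_mul _ _).le)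
  refine (abs_add_le _ _).trans ?_
  rw [abs_mul, abs_mul, abs_of_nonneg hp.1, abs_of_nonneg (sub_nonneg.2 hp.2)]
  nlinarith [mul_le_mul_of_nonneg_left (le_max_left |a - a'| |b - b'|) hp.1,
    mul_le_mul_of_nonneg_left (le_max_right |a - a'| |b - b'|) (sub_nonneg.2 hp.2)]

theorem ofReal_abs_convexCombination_sub_le {a a' b b' p p' : ℝ} (hp : p ∈ Icc (0 : ℝ) 1)
    {G : ℝ≥0∞} (ha : ENNReal.ofReal |a - a'| ≤ G) (hb : ENNReal.ofReal |b - b'| ≤ G) :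
    ENNReal.ofReal |p * a + (1 - p) * b - (p' * a' + (1 - p') * b')| ≤
      G + ENNReal.ofReal (|p - p'| * |a' - b'|) := by
  refine (ENNReal.ofReal_le_ofReal (abs_convexCombination_sub_le hp)).trans ?_
  rw [ENNReal.ofReal_add (by positivity) (by positivity)]
  refine add_le_add ?_ le_rfl
  rcases max_choice |a - a'| |b - b'| with h | h <;> rw [h] <;> assumption

theorem LocallyGlued.exists_lipschitzOnWith (hv : ∀ n, LocallyLipschitzOn (S n) (v n)) {x : X}
    (hx : LocallyGlued S v w H x) : ∃ K : ℝ≥0, ∃ t ∈ 𝓝 x, LipschitzOnWith K w t := by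
  obtain ⟨N, hN, m, n, hNS, φ, K, hφL, hφ, hw, -⟩ := hx
  have hmem : ∀ k, N ⊆ S k → ∃ L : ℝ≥0, ∃ t ∈ 𝓝 x, LipschitzOnWith L (v k) t := by
    intro k hk
    obtain ⟨L, t, ht, hL⟩ := hv k (hk (mem_of_mem_nhds hN))
    rw [nhdsWithin_eq_nhds.2 (mem_of_superset hN hk)] at ht
    exact ⟨L, t, ht, hL⟩
  obtain ⟨Lm, tm, htm, hLm⟩ := hmem m fun y hy => (hNS hy).1
  obtain ⟨Ln, tn, htn, hLn⟩ := hmem n fun y hy => (hNS hy).2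
  have hcont : ContinuousAt (fun y => |v m y - v n y|) x :=
    ((hLm.continuousOn.continuousAt htm).sub (hLn.continuousOn.continuousAt htn)).abs
  have hbd := hcont.eventually_lt_const (lt_add_one |v m x - v n x|)
  refine ⟨max Lm Ln + K * (‖v m x - v n x‖₊ + 1), _,
    inter_mem hbd (inter_mem hN (inter_mem htm htn)), LipschitzOnWith.of_dist_le_mul ?_⟩
  rintro y ⟨-, hyN, hym, hyn⟩ z ⟨hz, hzN, hzm, hzn⟩
  rw [Real.dist_eq, hw y hyN, hw z hzN]
  refine (abs_convexCombination_sub_le (hφ y hyN)).trans ?_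
  have h1 := hLm.dist_le_mul y hym z hzm
  have h2 := hLn.dist_le_mul y hyn z hzn
  have h3 := hφL.dist_le_mul y hyN z hzN
  rw [Real.dist_eq] at h1 h2 h3
  push_cast
  rw [add_mul, Real.norm_eq_abs]
  refine add_le_add (max_le (h1.trans ?_) (h2.trans ?_)) ?_
  · exact mul_le_mul_of_nonneg_right (le_max_left _ _) dist_nonneg
  · exact mul_le_mul_of_nonneg_right (le_max_right _ _) dist_nonneg
  · calc _ ≤ (K * dist y z) * (|v m x - v n x| + 1) :=
          mul_le_mul h3 (le_of_lt hz) (abs_nonneg _) (by positivity)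
      _ = _ := by ring

/-- On a short subcurve only `v m` and `v n` occur. Their increments are controlled by `g m` and `g
n`; the increment of the weight contributes `K (t - s)` times |v m - v n| frozen at the end point.
Continuity allows that frozen value to be replaced by the one at each parameter, hence by `H`, up to
an error `ε` per unit length. -/
theorem upperGradientIneq_glued (hv : ∀ n, ContinuousOn (v n) (S n)) (γ : Curve X)
    (hglue : ∀ s ∈ Icc 0 γ.length, LocallyGlued S v w H (γ.arcLength s))
    (hg : ∀ (n : ℕ) (s t : ℝ) (hs : 0 ≤ s) (hst : s ≤ t) (ht : t ≤ γ.length),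
      (γ.sub hs hst ht).LiesIn (S n) → UpperGradientIneq (v n) (g n) (γ.sub hs hst ht)) :
    UpperGradientIneq w (gluedGradient S g H) γ := by
  have hc := γ.lipschitzOnWith_arcLength.continuousOn
  have main := ofReal_abs_sub_le_of_locally (F := fun s => w (γ.arcLength s))
    (h := fun s => gluedGradient S g H (γ.arcLength s)) γ.length_nonneg ?_
  · simpa only [UpperGradientIneq, Curve.lineIntegral, γ.arcLength_zero, γ.arcLength_length]
      using main
  intro ε hε p hp
  obtain ⟨N, hN, m, n, hNS, φ, K, hφL, hφ, hw, hH⟩ := hglue p hp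
  have hNp := mem_of_mem_nhds hN
  have hdiff : ContinuousWithinAt (fun s => v m (γ.arcLength s) - v n (γ.arcLength s))
      (Icc 0 γ.length) p := by
    have hmem : ∀ k, S k ∈ 𝓝 (γ.arcLength p) →
        ContinuousWithinAt (fun s => v k (γ.arcLength s)) (Icc 0 γ.length) p := fun k hk =>
      ((hv k).continuousAt hk).comp_continuousWithinAt (hc p hp)
    exact (hmem m (mem_of_superset hN fun y hy => (hNS hy).1)).sub
      (hmem n (mem_of_superset hN fun y hy => (hNS hy).2))
  -- Two values in a ball of this radius differ by at most `ε / (K + 1)`, which stays below `ε`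
  -- after multiplication by `K`.
  have hη : 0 < ε / (2 * (K + 1)) := by positivity
  have hev := ((hc p hp).eventually_mem hN).and
    (hdiff.eventually_mem (Metric.ball_mem_nhds _ hη))
  obtain ⟨δ, hδ, hball⟩ := Metric.mem_nhdsWithin_iff.1 hev
  refine ⟨δ, hδ, fun s hs t ht hst hsp htp => ?_⟩
  have hr : ∀ r ∈ Icc s t, γ.arcLength r ∈ N ∧
      v m (γ.arcLength r) - v n (γ.arcLength r) ∈
        Metric.ball (v m (γ.arcLength p) - v n (γ.arcLength p)) (ε / (2 * (K + 1))) := by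
    intro r hr
    refine hball ⟨?_, hs.1.trans hr.1, hr.2.trans ht.2⟩
    rw [Real.ball_eq_Ioo] at hsp htp ⊢
    exact ⟨hsp.1.trans_le hr.1, hr.2.trans_lt htp.2⟩
  have hsN := (hr s (left_mem_Icc.2 hst)).1
  have htN := (hr t (right_mem_Icc.2 hst)).1
  have hG : ∀ k, (∀ y ∈ N, y ∈ S k) → ENNReal.ofReal |v k (γ.arcLength s) - v k (γ.arcLength t)| ≤
      ∫⁻ r in Icc s t, ⨆ n, (S n).indicator (g n) (γ.arcLength r) := by
    intro k hk
    have h1 : ENNReal.ofReal |v k (γ.arcLength s) - v k (γ.arcLength t)| ≤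
        (γ.sub hs.1 hst ht.2).lineIntegral (g k) :=
      hg k s t hs.1 hst ht.2 fun r hrr => hk _ (hr r hrr).1
    rw [Curve.lineIntegral_sub] at h1
    refine h1.trans (setLIntegral_mono' measurableSet_Icc fun r hrr => ?_)
    refine le_iSup_of_le k ?_
    rw [indicator_of_mem (hk _ (hr r hrr).1)]
  have h2 : ENNReal.ofReal (|φ (γ.arcLength s) - φ (γ.arcLength t)| *
      |v m (γ.arcLength t) - v n (γ.arcLength t)|) ≤
      (∫⁻ r in Icc s t, H (γ.arcLength r)) + ENNReal.ofReal (ε * (t - s)) := by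
    have h3 : |φ (γ.arcLength s) - φ (γ.arcLength t)| ≤ K * (t - s) := by
      have := hφL.dist_le_mul _ hsN _ htN
      rw [Real.dist_eq] at this
      exact this.trans (mul_le_mul_of_nonneg_left (γ.dist_arcLength_le hs ht hst) K.2)
    have h4 : ENNReal.ofReal (|φ (γ.arcLength s) - φ (γ.arcLength t)| *
        |v m (γ.arcLength t) - v n (γ.arcLength t)|) ≤
        ∫⁻ r in Icc s t, ENNReal.ofReal (K * |v m (γ.arcLength t) - v n (γ.arcLength t)|) := by
      rw [setLIntegral_const, Real.volume_Icc, ← ENNReal.ofReal_mul (by positivity)]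
      refine ENNReal.ofReal_le_ofReal ?_
      nlinarith [mul_le_mul_of_nonneg_right h3
        (abs_nonneg (v m (γ.arcLength t) - v n (γ.arcLength t)))]
    have h5 : ∫⁻ r in Icc s t, ENNReal.ofReal (K * |v m (γ.arcLength t) - v n (γ.arcLength t)|) ≤
        ∫⁻ r in Icc s t, (H (γ.arcLength r) + ENNReal.ofReal ε) := by
      refine setLIntegral_mono' measurableSet_Icc fun r hrr => ?_
      refine le_trans ?_ (add_le_add (hH _ (hr r hrr).1) le_rfl)
      rw [← ENNReal.ofReal_add (by positivity) hε.le]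
      refine ENNReal.ofReal_le_ofReal ?_
      have h6 := (hr r hrr).2
      have h7 := (hr t (right_mem_Icc.2 hst)).2
      rw [Metric.mem_ball] at h6 h7
      have h8 := dist_triangle_right (v m (γ.arcLength t) - v n (γ.arcLength t))
        (v m (γ.arcLength r) - v n (γ.arcLength r)) (v m (γ.arcLength p) - v n (γ.arcLength p))
      rw [Real.dist_eq] at h8
      have h9 : |v m (γ.arcLength t) - v n (γ.arcLength t)| ≤
          |v m (γ.arcLength r) - v n (γ.arcLength r)| + ε / (K + 1) := by
        have e1 : ε / (K + 1) = ε / (2 * (K + 1)) + ε / (2 * (K + 1)) := by field_simp; ring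
        have e2 := abs_sub_abs_le_abs_sub (v m (γ.arcLength t) - v n (γ.arcLength t))
          (v m (γ.arcLength r) - v n (γ.arcLength r))
        linarith
      have e3 : K * (ε / (K + 1)) ≤ ε := by
        rw [mul_div_assoc', div_le_iff₀ (by positivity)]
        nlinarith [K.coe_nonneg]
      nlinarith [mul_le_mul_of_nonneg_left h9 K.coe_nonneg]
    refine (h4.trans h5).trans (le_of_eq ?_)
    rw [lintegral_add_right _ measurable_const, setLIntegral_const, Real.volume_Icc,
      ← ENNReal.ofReal_mul hε.le]
  simp only [hw _ hsN, hw _ htN]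
  refine (ofReal_abs_convexCombination_sub_le (hφ _ hsN) (hG m fun y hy => (hNS hy).1)
    (hG n fun y hy => (hNS hy).2)).trans ((add_le_add le_rfl h2).trans ?_)
  rw [← add_assoc]
  exact add_le_add (le_lintegral_add _ _) le_rfl

variable [MeasurableSpace X] {μ : Measure X} {U : Set X}

theorem gradientIntegral_lt_iff {u : X → ℝ} {c : ℝ≥0∞} :
    gradientIntegral μ u U < c ↔ ∃ g, IsWeakUpperGradient μ u g U ∧ ∫⁻ x in U, g x ∂μ < c := by
  simp only [gradientIntegral, iInf_lt_iff, exists_prop]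

theorem gradientIntegral_le {u : X → ℝ} {g : X → ℝ≥0∞} (hg : IsWeakUpperGradient μ u g U) :
    gradientIntegral μ u U ≤ ∫⁻ x in U, g x ∂μ :=
  iInf₂_le g hg

theorem IsWeakUpperGradient.mono {u : X → ℝ} {g : X → ℝ≥0∞} {V : Set X}
    (h : IsWeakUpperGradient μ u g U) (hVU : V ⊆ U) : IsWeakUpperGradient μ u g V :=
  ⟨h.1.mono_measure (Measure.restrict_mono hVU le_rfl), le_antisymm
    ((modulusOne_mono fun _ hγ => And.intro (fun t ht => hVU (hγ.1 t ht)) hγ.2).trans h.2.le)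
    zero_le⟩

/-- A curve violating the glued inequality has a subcurve in some `S n` that violates the inequality
for `v n`; such subcurves form a countable union of null families. -/
theorem isWeakUpperGradient_glued (hS : ∀ n, MeasurableSet (S n)) (hSU : ∀ n, S n ⊆ U)
    (hv : ∀ n, ContinuousOn (v n) (S n)) (hg : ∀ n, IsWeakUpperGradient μ (v n) (g n) (S n))
    (hH : AEMeasurable H (μ.restrict U)) (hglue : ∀ x ∈ U, LocallyGlued S v w H x) :
    IsWeakUpperGradient μ w (gluedGradient S g H) U := by
  refine ⟨(AEMeasurable.iSup fun n => ?_).add hH, ?_⟩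
  · refine (aemeasurable_indicator_iff (hS n)).2 ?_
    rw [Measure.restrict_restrict_of_subset (hSU n)]
    exact (hg n).1
  · refine modulusOne_subcurve_eq_zero (modulusOne_iUnion_eq_zero fun n => (hg n).2) ?_
    rintro γ ⟨hγU, hγ⟩
    by_contra hcon
    push Not at hcon
    refine hγ (upperGradientIneq_glued hv γ (fun s hs => hglue _ (hγU.arcLength_mem hs)) ?_)
    intro n s t hs hst ht hlies
    by_contra hn
    exact hcon s t hs hst ht (mem_iUnion.2 ⟨n, hlies, hn⟩)

theorem lintegral_gluedGradient_le (hS : ∀ n, MeasurableSet (S n)) (hSU : ∀ n, S n ⊆ U)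
    (hg : ∀ n, IsWeakUpperGradient μ (v n) (g n) (S n)) (hH : AEMeasurable H (μ.restrict U)) :
    ∫⁻ x in U, gluedGradient S g H x ∂μ ≤
      (∑' n, ∫⁻ x in S n, g n x ∂μ) + ∫⁻ x in U, H x ∂μ := by
  have hm : ∀ n, AEMeasurable ((S n).indicator (g n)) (μ.restrict U) := fun n => by
    refine (aemeasurable_indicator_iff (hS n)).2 ?_
    rw [Measure.restrict_restrict_of_subset (hSU n)]
    exact (hg n).1
  simp only [gluedGradient]
  rw [lintegral_add_right' _ hH]
  refine add_le_add ?_ le_rfl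
  refine (lintegral_mono fun x => iSup_le fun n => ENNReal.le_tsum n).trans ?_
  rw [lintegral_tsum hm]
  refine ENNReal.tsum_le_tsum fun n => ?_
  rw [lintegral_indicator (hS n), Measure.restrict_restrict_of_subset (hSU n)]

/-- The gradient integral of a function glued from a sequence of functions. -/
theorem gradientIntegral_glued_le (hS : ∀ n, MeasurableSet (S n)) (hSU : ∀ n, S n ⊆ U)
    (hv : ∀ n, ContinuousOn (v n) (S n)) (hH : AEMeasurable H (μ.restrict U))
    (hglue : ∀ x ∈ U, LocallyGlued S v w H x) :
    gradientIntegral μ w U ≤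
      (∑' n, gradientIntegral μ (v n) (S n)) + ∫⁻ x in U, H x ∂μ := by
  refine ENNReal.le_of_forall_pos_le_add fun ε hε hfin => ?_
  obtain ⟨δ, hδ, hsum⟩ := ENNReal.exists_pos_sum_of_countable
    (ENNReal.coe_ne_zero.2 hε.ne') ℕ
  have hne : ∀ n, gradientIntegral μ (v n) (S n) ≠ ∞ := fun n =>
    ((ENNReal.le_tsum n).trans_lt ((le_add_right le_rfl).trans_lt hfin)).ne
  have h1 : ∀ n, ∃ g, IsWeakUpperGradient μ (v n) g (S n) ∧
      ∫⁻ x in S n, g x ∂μ < gradientIntegral μ (v n) (S n) + δ n := by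
    intro n
    exact gradientIntegral_lt_iff.1
      (ENNReal.lt_add_right (hne n) (ENNReal.coe_ne_zero.2 (hδ n).ne'))
  choose g hg hgi using h1
  refine (gradientIntegral_le (isWeakUpperGradient_glued hS hSU hv hg hH hglue)).trans ?_
  refine (lintegral_gluedGradient_le hS hSU hg hH).trans ?_
  rw [add_right_comm]
  refine add_le_add ?_ le_rfl
  refine (ENNReal.tsum_le_tsum fun n => (hgi n).le).trans ?_
  rw [ENNReal.tsum_add]
  exact add_le_add le_rfl hsum.le

/-! ### Elementary properties of the gradient integral -/

theorem gradientIntegral_add_le {V W : Set X} (hV : MeasurableSet V) (hVW : Disjoint V W)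
    (hVU : V ⊆ U) (hWU : W ⊆ U) (u : X → ℝ) :
    gradientIntegral μ u V + gradientIntegral μ u W ≤ gradientIntegral μ u U := by
  refine le_iInf₂ fun g hg => ?_
  refine (add_le_add (gradientIntegral_le (hg.mono hVU))
    (gradientIntegral_le (hg.mono hWU))).trans ?_
  rw [add_comm, ← lintegral_union hV hVW.symm]
  exact lintegral_mono_set (union_subset hWU hVU)

theorem IsWeakUpperGradient.sub {u u' : X → ℝ} {g g' : X → ℝ≥0∞}
    (h : IsWeakUpperGradient μ u g U) (h' : IsWeakUpperGradient μ u' g' U) :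
    IsWeakUpperGradient μ (fun x => u x - u' x) (fun x => g x + g' x) U := by
  refine ⟨h.1.add h'.1, le_antisymm (le_trans (modulusOne_mono ?_) (modulusOne_iUnion_eq_zero
    (Γ := fun n : ℕ => if n = 0 then {γ | γ.LiesIn U ∧ ¬ UpperGradientIneq u g γ}
      else {γ | γ.LiesIn U ∧ ¬ UpperGradientIneq u' g' γ}) ?_).le) zero_le⟩
  · rintro γ ⟨hγU, hγ⟩
    by_contra hcon
    simp only [mem_iUnion, not_exists] at hcon
    have h0 := hcon 0
    have h1 := hcon 1
    simp only [if_true, one_ne_zero, if_false, mem_ofPred_eq, not_and, not_not] at h0 h1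
    refine hγ (le_trans ?_ ((add_le_add (h0 hγU) (h1 hγU)).trans (le_lintegral_add _ _)))
    rw [← ENNReal.ofReal_add (abs_nonneg _) (abs_nonneg _)]
    refine ENNReal.ofReal_le_ofReal ?_
    rw [sub_sub_sub_comm]
    exact abs_sub _ _
  · intro n
    by_cases hn : n = 0
    · simpa only [hn, if_true] using h.2
    · simpa only [hn, if_false] using h'.2

theorem gradientIntegral_sub_le (u u' : X → ℝ) :
    gradientIntegral μ (fun x => u x - u' x) U ≤
      gradientIntegral μ u U + gradientIntegral μ u' U := by
  refine ENNReal.le_of_forall_pos_le_add fun ε hε hfin => ?_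
  obtain ⟨h1, h2⟩ := ENNReal.add_lt_top.1 hfin
  have hε2 : (ε : ℝ≥0∞) / 2 ≠ 0 := by simpa using hε.ne'
  obtain ⟨g, hg, hgi⟩ := gradientIntegral_lt_iff.1 (ENNReal.lt_add_right h1.ne hε2)
  obtain ⟨g', hg', hgi'⟩ := gradientIntegral_lt_iff.1 (ENNReal.lt_add_right h2.ne hε2)
  refine (gradientIntegral_le (hg.sub hg')).trans ?_
  rw [lintegral_add_left' hg.1]
  refine (add_le_add hgi.le hgi'.le).trans (le_of_eq ?_)
  rw [add_add_add_comm, ENNReal.add_halves]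

theorem gradientIntegral_zero : gradientIntegral μ (fun _ => 0) U = 0 := by
  have h : IsWeakUpperGradient μ (fun _ => 0) (fun _ => 0) U := by
    refine ⟨aemeasurable_const, le_antisymm ?_ zero_le⟩
    refine iInf_le_of_le (fun _ => 0) (iInf_le_of_le measurable_const (iInf_le_of_le ?_ (by simp)))
    rintro γ ⟨-, hγ⟩
    exact absurd (by simp [UpperGradientIneq]) hγ
  exact le_antisymm ((gradientIntegral_le h).trans (by simp)) zero_le

end Gluing

/-! ### Doubling spaces are proper -/

theorem IsDoubling.exists_pow_mul {X : Type*} [MetricSpace X] [MeasurableSpace X] {μ : Measure X}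
    (hμ : IsDoubling μ) : ∃ C : ℝ≥0, ∀ (x : X) (r : ℝ), 0 < r → ∀ n : ℕ,
      μ (Metric.ball x (2 ^ n * r)) ≤ (C : ℝ≥0∞) ^ n * μ (Metric.ball x r) := by
  obtain ⟨C, -, h⟩ := hμ
  refine ⟨C, fun x r hr n => ?_⟩
  induction n with
  | zero => simp
  | succ n ih =>
    rw [pow_succ', mul_assoc, pow_succ', mul_assoc]
    exact (h x _ (by positivity)).2.1.trans (mul_le_mul_right ih _)

/-- In a closed ball take a maximal `ε / 2`-separated set. The balls of radius `ε / 4` about its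
points are disjoint, lie in one ball of finite measure, and by doubling have measure bounded below.
So the set is finite, and by maximality it is an `ε`-net. -/
theorem IsDoubling.properSpace {X : Type*} [MetricSpace X] [CompleteSpace X] [MeasurableSpace X]
    [BorelSpace X] {μ : Measure X} (hμ : IsDoubling μ) : ProperSpace X := by
  obtain ⟨C, hC⟩ := hμ.exists_pow_mul
  obtain ⟨_, -, hμ⟩ := hμ
  refine ⟨fun x R => TotallyBounded.isCompact_of_isClosed ?_ Metric.isClosed_closedBall⟩
  rcases lt_or_ge R 0 with hR | hR
  · rw [Metric.closedBall_eq_empty.2 hR]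
    exact totallyBounded_empty
  refine Metric.totallyBounded_iff.2 fun ε hε => ?_
  obtain ⟨N, hN⟩ := zorn_subset {N | N ⊆ Metric.closedBall x R ∧
      Metric.IsSeparated (((ε / 2).toNNReal : ℝ≥0) : ℝ≥0∞) N} (by
    intro c hc hchain
    refine ⟨⋃₀ c, ⟨sUnion_subset fun s hs => (hc hs).1, ?_⟩, fun s hs => subset_sUnion_of_mem hs⟩
    exact (pairwise_sUnion hchain.directedOn).2 fun s hs => (hc hs).2)
  have hsep : ∀ y ∈ N, ∀ z ∈ N, y ≠ z → ε / 2 < dist y z := fun y hy z hz hyz => by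
    have := hN.prop.2 hy hz hyz
    change ENNReal.ofReal (ε / 2) < edist y z at this
    rw [edist_dist] at this
    exact (ENNReal.ofReal_lt_ofReal_iff_of_nonneg (by positivity)).1 this
  refine ⟨N, ?_, ?_⟩
  -- With this `n`, enlarging a ball of radius `ε / 4` about a point of `N` by `2 ^ n` makes it
  -- contain the ball of radius `R + 1` about `x`.
  · obtain ⟨n, hn⟩ := pow_unbounded_of_one_lt ((2 * R + 1) / (ε / 4)) (one_lt_two (α := ℝ))
    rw [div_lt_iff₀ (by positivity)] at hn
    have hpos : 0 < μ (Metric.ball x (R + 1)) := by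
      have := (hμ x ((R + 1) / 2) (by positivity)).1
      rwa [mul_div_cancel₀ _ (two_ne_zero' ℝ)] at this
    have hfin := Measure.finite_const_le_meas_of_disjoint_iUnion μ
      (ε := μ (Metric.ball x (R + 1)) / ((C : ℝ≥0∞) ^ n + 1))
      (As := fun y : N => Metric.ball (y : X) (ε / 4)) ?_ (fun _ => Metric.isOpen_ball.measurableSet)
      ?_ ?_
    · refine finite_univ_iff.1 (hfin.subset fun y _ => ENNReal.div_le_of_le_mul' ?_)
      refine (measure_mono (Metric.ball_subset_ball' ?_)).trans
        ((hC y (ε / 4) (by positivity) n).trans (mul_le_mul_left le_self_add _))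
      have := hN.prop.1 y.2
      rw [Metric.mem_closedBall, dist_comm] at this
      linarith
    · exact ENNReal.div_pos hpos.ne' (by finiteness)
    · intro y z hyz
      refine Metric.ball_disjoint_ball ?_
      have := hsep y y.2 z z.2 (Subtype.coe_ne_coe.2 hyz)
      linarith
    · refine ne_top_of_le_ne_top (hμ x (R + ε) (by positivity)).2.2.ne (measure_mono ?_)
      refine iUnion_subset fun y => Metric.ball_subset_ball' ?_
      have := hN.prop.1 y.2
      rw [Metric.mem_closedBall] at this
      linarith
  · refine (Metric.IsCover.of_maximal_isSeparated hN).subset_iUnion_closedBall.trans ?_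
    refine iUnion₂_mono fun y _ => Metric.closedBall_subset_ball ?_
    rw [Real.coe_toNNReal _ (by positivity)]
    linarith

/-! ### Locally Lipschitz functions -/

section LipLoc

variable {X : Type*} [MetricSpace X] {U V : Set X}

theorem CompactlyInside.mono (h : CompactlyInside V U) {W : Set X} (hUW : U ⊆ W) :
    CompactlyInside V W :=
  ⟨h.1, h.2.1, h.2.2.trans hUW⟩

theorem IsLipLoc.mono {v : X → ℝ} (h : IsLipLoc v U) (hVU : V ⊆ U) : IsLipLoc v V :=
  fun W hW => h W (hW.mono hVU)

/-- Properness makes small balls compactly inside `U`; conversely, local Lipschitz bounds become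
uniform on a compact closure. Gluing works with the pointwise form. -/
theorem isLipLoc_iff [ProperSpace X] (hU : IsOpen U) {v : X → ℝ} :
    IsLipLoc v U ↔ LocallyLipschitzOn U v := by
  constructor
  · intro h x hx
    obtain ⟨r, hr, hrU⟩ := Metric.isOpen_iff.1 hU x hx
    have hcl : closure (Metric.ball x (r / 2)) ⊆ Metric.closedBall x (r / 2) :=
      Metric.closure_ball_subset_closedBall
    obtain ⟨K, hK⟩ := h (Metric.ball x (r / 2)) ⟨Metric.isOpen_ball,
      (isCompact_closedBall x (r / 2)).of_isClosed_subset isClosed_closure hcl,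
      hcl.trans ((Metric.closedBall_subset_ball (half_lt_self hr)).trans hrU)⟩
    exact ⟨K, _, mem_nhdsWithin_of_mem_nhds (Metric.ball_mem_nhds x (half_pos hr)), hK⟩
  · intro h V hV
    obtain ⟨K, hK⟩ := (h.mono hV.2.2).exists_lipschitzOnWith_of_compact hV.2.1
    exact ⟨K, hK.mono subset_closure⟩

theorem IsLipLoc.continuousOn [ProperSpace X] (hU : IsOpen U) {v : X → ℝ} (h : IsLipLoc v U) :
    ContinuousOn v U :=
  ((isLipLoc_iff hU).1 h).continuousOn

/-- A `1`-Lipschitz function that is positive exactly in the open set `U` and whose superlevel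
sets are compact. -/
noncomputable def depth (U : Set X) (o x : X) : ℝ :=
  min (Metric.infDist x Uᶜ) (1 / (1 + dist x o))

variable {o : X}

theorem lipschitzWith_depth : LipschitzWith 1 (depth U o) := by
  have h : LipschitzWith 1 fun x : X => 1 / (1 + dist x o) := by
    refine LipschitzWith.of_dist_le_mul fun x y => ?_
    rw [NNReal.coe_one, one_mul, Real.dist_eq,
      div_sub_div _ _ (by positivity) (by positivity), abs_div,
      div_le_iff₀ (by positivity)]
    have h1 := abs_dist_sub_le x y o
    rw [abs_sub_comm] at h1
    have h2 : (1 : ℝ) ≤ |(1 + dist x o) * (1 + dist y o)| := by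
      rw [abs_of_nonneg (by positivity)]
      nlinarith [dist_nonneg (x := x) (y := o), dist_nonneg (x := y) (y := o),
        mul_nonneg (dist_nonneg (x := x) (y := o)) (dist_nonneg (x := y) (y := o))]
    have h3 : (1 * (1 + dist y o) - (1 + dist x o) * 1) = dist y o - dist x o := by ring
    rw [h3]
    nlinarith [dist_nonneg (x := x) (y := y)]
  have := (Metric.lipschitz_infDist_pt Uᶜ).min h
  rwa [max_self] at this

theorem continuous_depth : Continuous (depth U o) := lipschitzWith_depth.continuous

theorem depth_pos_iff (hU : IsOpen U) (hU' : Uᶜ.Nonempty) {x : X} :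
    0 < depth U o x ↔ x ∈ U := by
  rw [depth, lt_min_iff, and_iff_left (by positivity),
    ← hU.isClosed_compl.notMem_iff_infDist_pos hU', notMem_compl_iff]

theorem depth_nonneg {x : X} : 0 ≤ depth U o x :=
  le_min Metric.infDist_nonneg (by positivity)

theorem isCompact_le_depth [ProperSpace X] {s : ℝ} (hs : 0 < s) :
    IsCompact {x | s ≤ depth U o x} := by
  refine (isCompact_closedBall o (1 / s)).of_isClosed_subset
    (isClosed_le continuous_const continuous_depth) fun x hx => ?_
  have h1 : s ≤ 1 / (1 + dist x o) := le_trans hx (min_le_right _ _)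
  rw [Metric.mem_closedBall, le_div_iff₀ hs]
  rw [le_div_iff₀ (by positivity)] at h1
  nlinarith

/-- A shell `{s < depth < t}` is compactly inside each set that contains `{s ≤ depth ≤ t}`. -/
theorem compactlyInside_shell [ProperSpace X] {s t : ℝ} (hs : 0 < s) {W : Set X}
    (hW : ∀ x, s ≤ depth U o x → depth U o x ≤ t → x ∈ W) :
    CompactlyInside {x | s < depth U o x ∧ depth U o x < t} W := by
  have hcl : closure {x | s < depth U o x ∧ depth U o x < t} ⊆
      {x | s ≤ depth U o x ∧ depth U o x ≤ t} :=
    closure_minimal (fun x hx => ⟨hx.1.le, hx.2.le⟩)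
      ((isClosed_le continuous_const continuous_depth).inter
        (isClosed_le continuous_depth continuous_const))
  exact ⟨(isOpen_lt continuous_const continuous_depth).inter
    (isOpen_lt continuous_depth continuous_const),
    (isCompact_le_depth hs).of_isClosed_subset isClosed_closure fun x hx => (hcl hx).1,
    fun x hx => hW x (hcl hx).1 (hcl hx).2⟩

theorem compactlyInside_lt_depth [ProperSpace X] {s : ℝ} (hs : 0 < s) {W : Set X}
    (hW : ∀ x, s ≤ depth U o x → x ∈ W) : CompactlyInside {x | s < depth U o x} W := by
  have hcl : closure {x | s < depth U o x} ⊆ {x | s ≤ depth U o x} :=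
    closure_minimal (fun x hx => show s ≤ depth U o x from le_of_lt hx) (
      isClosed_le continuous_const continuous_depth)
  exact ⟨isOpen_lt continuous_const continuous_depth,
    (isCompact_le_depth hs).of_isClosed_subset isClosed_closure hcl, fun x hx => hW x (hcl hx)⟩

theorem CompactlyInside.exists_lt_depth (hV : CompactlyInside V U) (hU : IsOpen U)
    (hU' : Uᶜ.Nonempty) : ∃ s > 0, ∀ x ∈ V, s < depth U o x := by
  obtain rfl | hne := V.eq_empty_or_nonempty
  · exact ⟨1, one_pos, fun x hx => hx.elim⟩
  obtain ⟨x, hx, hmin⟩ := hV.2.1.exists_isMinOn hne.closure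
    (continuous_depth (U := U) (o := o)).continuousOn
  have hpos := (depth_pos_iff (o := o) hU hU').2 (hV.2.2 hx)
  exact ⟨depth U o x / 2, half_pos hpos, fun y hy =>
    (half_lt_self hpos).trans_le (hmin (subset_closure hy))⟩

end LipLoc

/-! ### Total variation -/

section TotalVariation

theorem lintegral_enorm_sub_le {X : Type*} [MeasurableSpace X] {μ : Measure X}
    {f g h : X → ℝ} (hf : AEMeasurable f μ) (hg : AEMeasurable g μ) :
    ∫⁻ x, ‖f x - h x‖ₑ ∂μ ≤ (∫⁻ x, ‖f x - g x‖ₑ ∂μ) + ∫⁻ x, ‖g x - h x‖ₑ ∂μ := by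
  refine le_trans ?_ (lintegral_add_left' (hf.sub hg).enorm _).le
  refine lintegral_mono fun x => ?_
  rw [← sub_add_sub_cancel (f x) (g x) (h x), Pi.sub_apply]
  exact enorm_add_le _ _

theorem liminf_add_liminf_le (f g : ℕ → ℝ≥0∞) :
    liminf f atTop + liminf g atTop ≤ liminf (fun n => f n + g n) atTop := by
  simp only [liminf_eq_iSup_iInf_of_nat]
  refine ENNReal.iSup_add_iSup_le fun m n => le_iSup_of_le (max m n) ?_
  exact le_iInf₂ fun i hi => add_le_add (iInf₂_le i ((le_max_left m n).trans hi))
    (iInf₂_le i ((le_max_right m n).trans hi))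

variable {X : Type*} [MetricSpace X] [MeasurableSpace X] {μ : Measure X} {U V : Set X}

theorem exists_approx {u : X → ℝ} {c : ℝ≥0∞} (h : totalVariation μ u U < c)
    (hV : CompactlyInside V U) {ε : ℝ≥0∞} (hε : 0 < ε) :
    ∃ v, IsLipLoc v U ∧ ∫⁻ x in V, ‖v x - u x‖ₑ ∂μ < ε ∧ gradientIntegral μ v U < c := by
  simp only [totalVariation, iInf_lt_iff] at h
  obtain ⟨v, hv, hL, hlim⟩ := h
  obtain ⟨i, hi1, hi2⟩ := ((frequently_lt_of_liminf_lt (by isBoundedDefault) hlim).and_eventually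
    ((hL V hV).eventually (gt_mem_nhds hε))).exists
  exact ⟨v i, hv i, hi2, hi1⟩

theorem totalVariation_le_liminf {u : X → ℝ} {v : ℕ → X → ℝ} (hv : ∀ i, IsLipLoc (v i) U)
    (hL : TendstoL1Loc μ v u U) :
    totalVariation μ u U ≤ liminf (fun i => gradientIntegral μ (v i) U) atTop :=
  iInf_le_of_le v (iInf_le_of_le hv (iInf_le_of_le hL le_rfl))

/-- A diagonal choice: the sets {depth > δ n} exhaust `U`, and every set compactly inside `U` lies
in all but finitely many of them. A single approximant for each set and each error thus suffices,
without building sequences. -/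
theorem totalVariation_le [ProperSpace X] (hU : IsOpen U) (hU' : Uᶜ.Nonempty) {u : X → ℝ}
    {c : ℝ≥0∞} (h : ∀ V, CompactlyInside V U → ∀ ε : ℝ≥0, 0 < ε →
      ∃ v, IsLipLoc v U ∧ ∫⁻ x in V, ‖v x - u x‖ₑ ∂μ ≤ ε ∧ gradientIntegral μ v U ≤ c + ε) :
    totalVariation μ u U ≤ c := by
  obtain ⟨o, -⟩ := id hU'
  obtain ⟨δ, -, hδ, hδ0⟩ := exists_seq_strictAnti_tendsto (0 : ℝ≥0)
  have hV : ∀ n, CompactlyInside {x | (δ n : ℝ) < depth U o x} U := fun n =>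
    compactlyInside_lt_depth (by exact_mod_cast hδ n) fun x hx =>
      (depth_pos_iff hU hU').1 (lt_of_lt_of_le (by exact_mod_cast hδ n) hx)
  choose v hv hL hg using fun n => h _ (hV n) (δ n) (hδ n)
  have hδ0' : Tendsto (fun n => (δ n : ℝ≥0∞)) atTop (𝓝 0) := by
    simpa using ENNReal.tendsto_coe.2 hδ0
  refine (totalVariation_le_liminf hv fun V hV => ?_).trans ?_
  · obtain ⟨s, hs, hsV⟩ := hV.exists_lt_depth (o := o) hU hU'
    have hev : ∀ᶠ n in atTop, (δ n : ℝ) < s :=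
      (NNReal.tendsto_coe.2 hδ0).eventually (gt_mem_nhds hs)
    refine tendsto_of_tendsto_of_tendsto_of_le_of_le' tendsto_const_nhds hδ0'
      (Eventually.of_forall fun _ => zero_le) (hev.mono fun n hn => ?_)
    exact (lintegral_mono_set fun x hx => hn.trans (hsV x hx)).trans (hL n)
  · refine (liminf_le_liminf (Eventually.of_forall hg)).trans (le_of_eq ?_)
    have : Tendsto (fun n => c + (δ n : ℝ≥0∞)) atTop (𝓝 (c + 0)) := tendsto_const_nhds.add hδ0'
    rw [this.liminf_eq, add_zero]

/-- An approximating sequence on `U` restricts to one on each part, and both the gradient integral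
and the lower limit are superadditive. -/
theorem totalVariation_add_le [OpensMeasurableSpace X] {W : Set X} (hV : IsOpen V)
    (hVW : Disjoint V W) (hVU : V ⊆ U) (hWU : W ⊆ U) (u : X → ℝ) :
    totalVariation μ u V + totalVariation μ u W ≤ totalVariation μ u U := by
  refine le_iInf fun v => le_iInf fun hv => le_iInf fun hL => ?_
  have key : ∀ W, W ⊆ U → totalVariation μ u W ≤
      liminf (fun i => gradientIntegral μ (v i) W) atTop := fun W hWU =>
    totalVariation_le_liminf (fun i => (hv i).mono hWU) fun V hV => hL V (hV.mono hWU)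
  refine (add_le_add (key V hVU) (key W hWU)).trans ((liminf_add_liminf_le _ _).trans ?_)
  exact liminf_le_liminf (Eventually.of_forall fun i =>
    gradientIntegral_add_le hV.measurableSet hVW hVU hWU _)

theorem totalVariation_mono [OpensMeasurableSpace X] {u : X → ℝ} {W : Set X} (hV : IsOpen V) (hVW : V ⊆ W) :
    totalVariation μ u V ≤ totalVariation μ u W :=
  le_self_add.trans (totalVariation_add_le hV (disjoint_empty V) hVW (empty_subset W) u)

variable [BorelSpace X] [ProperSpace X]

/-- Lower semicontinuity of the total variation. -/
theorem totalVariation_le_of_frequently (hU : IsOpen U) (hU' : Uᶜ.Nonempty) {u : X → ℝ}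
    {v : ℕ → X → ℝ} (hv : ∀ k, AEMeasurable (v k) (μ.restrict U)) {c : ℝ≥0∞}
    (hL : Tendsto (fun k => ∫⁻ x in U, ‖v k x - u x‖ₑ ∂μ) atTop (𝓝 0))
    (hc : ∃ᶠ k in atTop, totalVariation μ (v k) U ≤ c) : totalVariation μ u U ≤ c := by
  rcases eq_or_ne c ∞ with rfl | hfin
  · exact le_top
  refine totalVariation_le hU hU' fun V hV ε hε => ?_
  have hε2 : 0 < (ε : ℝ≥0∞) / 2 := ENNReal.half_pos (ENNReal.coe_ne_zero.2 hε.ne')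
  obtain ⟨k, hk1, hk2⟩ := (hc.and_eventually (hL.eventually (gt_mem_nhds hε2))).exists
  obtain ⟨w, hw, hwV, hwg⟩ := exists_approx
    (hk1.trans_lt (ENNReal.lt_add_right hfin (ENNReal.coe_ne_zero.2 hε.ne'))) hV hε2
  have hVU : V ⊆ U := subset_closure.trans hV.2.2
  have hm := Measure.restrict_mono hVU (le_refl μ)
  refine ⟨w, hw, ?_, hwg.le⟩
  refine (lintegral_enorm_sub_le (((hw.continuousOn hU).aemeasurable hU.measurableSet).mono_measure
    hm) ((hv k).mono_measure hm)).trans ?_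
  rw [← ENNReal.add_halves (ε : ℝ≥0∞)]
  exact add_le_add hwV.le ((lintegral_mono_set hVU).trans hk2.le)

theorem totalVariation_sub_le (hU : IsOpen U) (hU' : Uᶜ.Nonempty) {u u' : X → ℝ}
    (hu : AEMeasurable u (μ.restrict U)) :
    totalVariation μ (fun x => u x - u' x) U ≤ totalVariation μ u U + totalVariation μ u' U := by
  rcases eq_or_ne (totalVariation μ u U + totalVariation μ u' U) ∞ with hfin | hfin
  · exact hfin ▸ le_top
  refine totalVariation_le hU hU' fun V hV ε hε => ?_
  have hε2 : 0 < (ε : ℝ≥0∞) / 2 := ENNReal.half_pos (ENNReal.coe_ne_zero.2 hε.ne')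
  have hVU : V ⊆ U := subset_closure.trans hV.2.2
  have hm := Measure.restrict_mono hVU (le_refl μ)
  obtain ⟨h1, h2⟩ := ENNReal.add_ne_top.1 hfin
  obtain ⟨w, hw, hwV, hwg⟩ := exists_approx (ENNReal.lt_add_right h1 hε2.ne') hV hε2
  obtain ⟨w', hw', hwV', hwg'⟩ := exists_approx (ENNReal.lt_add_right h2 hε2.ne') hV hε2
  refine ⟨fun x => w x - w' x, ?_, ?_, ?_⟩
  · rw [isLipLoc_iff hU] at hw hw' ⊢
    exact hw.sub hw'
  · rw [← ENNReal.add_halves (ε : ℝ≥0∞)]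
    refine le_trans ?_ (add_le_add hwV.le hwV'.le)
    refine le_trans ?_ (lintegral_add_left' ((((hw.continuousOn hU).aemeasurable
      hU.measurableSet).mono_measure hm).sub (hu.mono_measure hm)).enorm _).le
    refine lintegral_mono fun x => ?_
    rw [sub_sub_sub_comm, Pi.sub_apply]
    exact enorm_sub_le
  · refine (gradientIntegral_sub_le _ _).trans ((add_le_add hwg.le hwg'.le).trans (le_of_eq ?_))
    rw [add_add_add_comm, ENNReal.add_halves]

end TotalVariation

/-! ### Cutting off near the complement of the boundary -/

/-- The piecewise linear function that is `0` on `(-∞, a]` and `1` on `[b, ∞)`. -/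
noncomputable def ramp (a b t : ℝ) : ℝ := max 0 (min 1 ((t - a) / (b - a)))

theorem ramp_mem (a b t : ℝ) : ramp a b t ∈ Icc (0 : ℝ) 1 :=
  ⟨le_max_left _ _, max_le zero_le_one (min_le_left _ _)⟩

theorem ramp_eq_zero {a b t : ℝ} (hab : a < b) (ht : t ≤ a) : ramp a b t = 0 :=
  max_eq_left ((min_le_right _ _).trans
    (div_nonpos_of_nonpos_of_nonneg (sub_nonpos.2 ht) (sub_pos.2 hab).le))

theorem ramp_eq_one {a b t : ℝ} (hab : a < b) (ht : b ≤ t) : ramp a b t = 1 := by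
  have h : 1 ≤ (t - a) / (b - a) := by
    rw [one_le_div (sub_pos.2 hab)]
    linarith
  rw [ramp, min_eq_left h, max_eq_right zero_le_one]

theorem enorm_cutoff_mul_le (a b t z : ℝ) : ‖(1 - ramp a b t) * z‖ₑ ≤ ‖z‖ₑ := by
  rw [enorm_mul]
  refine mul_le_of_le_one_left' ?_
  have := ramp_mem a b t
  rw [Real.enorm_eq_ofReal_abs, abs_of_nonneg (sub_nonneg.2 this.2)]
  exact ENNReal.ofReal_le_one.2 (by linarith [this.1])

theorem lipschitzWith_ramp {a b : ℝ} {K : ℝ≥0} (hab : a < b) (hK : 1 ≤ K * (b - a)) :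
    LipschitzWith K (ramp a b) := by
  have h : LipschitzWith K fun t : ℝ => (t - a) / (b - a) := by
    refine LipschitzWith.of_dist_le_mul fun s t => ?_
    rw [Real.dist_eq, Real.dist_eq, ← sub_div, sub_sub_sub_cancel_right, abs_div,
      abs_of_pos (sub_pos.2 hab), div_le_iff₀ (sub_pos.2 hab)]
    nlinarith [abs_nonneg (s - t)]
  exact (h.const_min 1).const_max 0

section

variable {X : Type*} [MetricSpace X] {Ω : Set X} {o : X}

theorem lipschitzWith_ramp_depth {a b : ℝ} {K : ℝ≥0} (hab : a < b) (hK : 1 ≤ K * (b - a)) :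
    LipschitzWith K fun x => ramp a b (depth Ω o x) := by
  have := (lipschitzWith_ramp hab hK).comp (lipschitzWith_depth (U := Ω) (o := o))
  rwa [mul_one] at this

theorem isOpen_lt_depth (s : ℝ) : IsOpen {x | s < depth Ω o x} :=
  isOpen_lt continuous_const continuous_depth

theorem isOpen_depth_lt (s : ℝ) : IsOpen {x | depth Ω o x < s} :=
  isOpen_lt continuous_depth continuous_const

theorem isOpen_shell (s t : ℝ) : IsOpen {x | s < depth Ω o x ∧ depth Ω o x < t} :=
  (isOpen_lt_depth s).inter (isOpen_depth_lt t)

theorem shell_mem_nhds {s t : ℝ} {x : X} (h1 : s < depth Ω o x) (h2 : depth Ω o x < t) :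
    {x | s < depth Ω o x ∧ depth Ω o x < t} ∈ 𝓝 x :=
  (isOpen_shell s t).mem_nhds ⟨h1, h2⟩

variable [MeasurableSpace X] {μ : Measure X}

/-- The cut off function is `w` glued to the zero function. The weight has slope `4 / c`, and the
gluing term is supported in `T`, which stays away from the edges of the layer so that L¹_loc
convergence in the layer controls it. -/
theorem gradientIntegral_cutoff_le [BorelSpace X] (hΩ : IsOpen Ω) (hΩ' : Ωᶜ.Nonempty) {c : ℝ}
    (hc : 0 < c) {w : X → ℝ}
    (hw : LocallyLipschitzOn {x | 0 < depth Ω o x ∧ depth Ω o x < c} w) :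
    LocallyLipschitzOn Ω (fun x => (1 - ramp (c / 4) (c / 2) (depth Ω o x)) * w x) ∧
    gradientIntegral μ (fun x => (1 - ramp (c / 4) (c / 2) (depth Ω o x)) * w x) Ω ≤
      gradientIntegral μ w {x | 0 < depth Ω o x ∧ depth Ω o x < c} + ENNReal.ofReal (4 / c) *
        ∫⁻ x in {x | c / 8 < depth Ω o x ∧ depth Ω o x < 7 * c / 8}, ‖w x‖ₑ ∂μ := by
  set U := {x | 0 < depth Ω o x ∧ depth Ω o x < c} with hU
  set T := {x | c / 8 < depth Ω o x ∧ depth Ω o x < 7 * c / 8} with hT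
  have hTU : T ⊆ U := fun x hx => ⟨by linarith [hx.1], by linarith [hx.2]⟩
  have hUΩ : U ⊆ Ω := fun x hx => (depth_pos_iff hΩ hΩ').1 hx.1
  let S : ℕ → Set X := fun n => if n = 0 then U else {x | c / 8 < depth Ω o x}
  let v : ℕ → X → ℝ := fun n => if n = 0 then w else fun _ => 0
  let H : X → ℝ≥0∞ := T.indicator fun x => ENNReal.ofReal (4 / c) * ‖w x‖ₑ
  have hS : ∀ n, IsOpen (S n) := fun n => by
    by_cases hn : n = 0
    · simpa only [S, hn, if_true] using isOpen_shell 0 c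
    · simpa only [S, hn, if_false] using isOpen_lt_depth _
  have hSΩ : ∀ n, S n ⊆ Ω := fun n => by
    by_cases hn : n = 0
    · simpa only [S, hn, if_true] using hUΩ
    · simp only [S, hn, if_false]
      exact fun x hx => (depth_pos_iff hΩ hΩ').1 (lt_trans (by positivity) hx)
  have hv : ∀ n, LocallyLipschitzOn (S n) (v n) := fun n => by
    by_cases hn : n = 0
    · simpa only [S, v, hn, if_true] using hw
    · simp only [v, hn, if_false]
      exact (LocallyLipschitz.const (0 : ℝ)).locallyLipschitzOn
  have hglue : ∀ x ∈ Ω, LocallyGlued S v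
      (fun x => (1 - ramp (c / 4) (c / 2) (depth Ω o x)) * w x) H x := by
    intro x hx
    have hpos := (depth_pos_iff (o := o) hΩ hΩ').2 hx
    have hlip : LipschitzWith (4 / c).toNNReal fun x => ramp (c / 4) (c / 2) (depth Ω o x) := by
      refine lipschitzWith_ramp_depth (by linarith) ?_
      rw [Real.coe_toNNReal _ (by positivity)]
      field_simp
      norm_num
    rcases lt_or_ge (depth Ω o x) (c / 4) with h | h
    · refine ⟨_, shell_mem_nhds hpos h, 0, 0, fun y hy => ⟨⟨hy.1, ?_⟩, ⟨hy.1, ?_⟩⟩, fun _ => 1, 0,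
        LipschitzWith.const' _ |>.lipschitzOnWith, fun y _ => by simp, fun y hy => ?_, by simp⟩
      · linarith [hy.2]
      · linarith [hy.2]
      · simp only [v, if_true]
        rw [ramp_eq_zero (by linarith) hy.2.le]
        ring
    rcases lt_or_ge (depth Ω o x) (7 * c / 8) with h' | h'
    · refine ⟨_, shell_mem_nhds (show c / 8 < _ by linarith) h', 1, 0,
        fun y hy => ⟨hy.1, hTU hy⟩, _, _, hlip.lipschitzOnWith, fun y _ => ramp_mem _ _ _,
        fun y _ => ?_, fun y hy => ?_⟩
      · simp [v]
      · simp only [v, H]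
        rw [indicator_of_mem hy, Real.coe_toNNReal _ (by positivity),
          ENNReal.ofReal_mul (by positivity), Real.enorm_eq_ofReal_abs]
        simp
    · refine ⟨_, (isOpen_lt_depth (c / 2)).mem_nhds (show c / 2 < depth Ω o x by linarith), 1, 1,
        fun y hy => ?_, fun _ => 1, 0, LipschitzWith.const' _ |>.lipschitzOnWith,
        fun y _ => by simp, fun y hy => ?_, by simp⟩
      · have : c / 8 < depth Ω o y := by linarith [show c / 2 < depth Ω o y from hy]
        exact ⟨this, this⟩
      · have hr : ramp (c / 4) (c / 2) (depth Ω o y) = 1 :=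
          ramp_eq_one (by linarith) (le_of_lt hy)
        simp [v, hr]
  constructor
  · intro x hx
    obtain ⟨K, t, ht, hK⟩ := (hglue x hx).exists_lipschitzOnWith hv
    exact ⟨K, t, mem_nhdsWithin_of_mem_nhds ht, hK⟩
  · have hTm : MeasurableSet T := (isOpen_shell _ _).measurableSet
    have hTΩ := hTU.trans hUΩ
    have hHm : AEMeasurable H (μ.restrict Ω) := by
      refine (aemeasurable_indicator_iff hTm).2 ?_
      rw [Measure.restrict_restrict_of_subset hTΩ]
      exact (((hw.continuousOn.mono hTU).aemeasurable hTm).enorm).const_mul _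
    refine (gradientIntegral_glued_le (fun n => (hS n).measurableSet) hSΩ
      (fun n => (hv n).continuousOn) hHm hglue).trans (add_le_add (le_of_eq ?_) (le_of_eq ?_))
    · rw [tsum_eq_single 0 fun n hn => by simp only [v, hn, if_false, gradientIntegral_zero]]
      simp only [v, S, if_true]
    · rw [lintegral_indicator hTm, Measure.restrict_restrict_of_subset hTΩ,
        lintegral_const_mul' _ _ ENNReal.ofReal_ne_top]

variable [BorelSpace X] [ProperSpace X]

/-- Approximants of `w` are needed in the layer only, since their cutoffs extend by zero to `Ω`. -/
theorem totalVariation_cutoff_le (hΩ : IsOpen Ω) (hΩ' : Ωᶜ.Nonempty) {c : ℝ} (hc : 0 < c)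
    {w : X → ℝ} (hw : AEMeasurable w (μ.restrict Ω)) :
    totalVariation μ (fun x => (1 - ramp (c / 4) (c / 2) (depth Ω o x)) * w x) Ω ≤
      totalVariation μ w {x | 0 < depth Ω o x ∧ depth Ω o x < c} +
        ENNReal.ofReal (4 / c) * ∫⁻ x in Ω, ‖w x‖ₑ ∂μ := by
  set U := {x | 0 < depth Ω o x ∧ depth Ω o x < c} with hU
  have hUo : IsOpen U := isOpen_shell _ _
  have hUΩ : U ⊆ Ω := fun x hx => (depth_pos_iff hΩ hΩ').1 hx.1
  rcases eq_or_ne (totalVariation μ w U) ∞ with hfin | hfin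
  · rw [hfin, top_add]
    exact le_top
  refine totalVariation_le hΩ hΩ' fun V hV ε hε => ?_
  set K : ℝ≥0 := (4 / c).toNNReal with hK
  -- The error enters once through the gradient and `K` times through the L¹ term.
  have hδ : 0 < ε / (1 + K) := by positivity
  have hδ' : (0 : ℝ≥0∞) < (ε / (1 + K) : ℝ≥0) := ENNReal.coe_pos.2 hδ
  obtain ⟨s, hs, hsV⟩ := hV.exists_lt_depth (o := o) hΩ hΩ'
  -- `V'` has to contain both the part of `V` where the cutoff may be nonzero and the region
  -- carrying the gluing term.
  have hs' : 0 < min s (c / 8) := lt_min hs (by positivity)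
  set V' := {x | min s (c / 8) < depth Ω o x ∧ depth Ω o x < 7 * c / 8} with hV'
  have hV'U : CompactlyInside V' U := compactlyInside_shell hs' fun x h1 h2 =>
    ⟨hs'.trans_le h1, by linarith⟩
  have hV'm : MeasurableSet V' := (isOpen_shell _ _).measurableSet
  have hV'Ω : V' ⊆ Ω := (subset_closure.trans hV'U.2.2).trans hUΩ
  obtain ⟨z, hz, hzL, hzg⟩ := exists_approx (ENNReal.lt_add_right hfin hδ'.ne') hV'U hδ'
  obtain ⟨h1, h2⟩ := gradientIntegral_cutoff_le (μ := μ) hΩ hΩ' hc ((isLipLoc_iff hUo).1 hz)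
  refine ⟨_, (isLipLoc_iff hΩ).2 h1, ?_, h2.trans ?_⟩
  · have hle : ∫⁻ x in V, ‖(1 - ramp (c / 4) (c / 2) (depth Ω o x)) * z x -
        (1 - ramp (c / 4) (c / 2) (depth Ω o x)) * w x‖ₑ ∂μ ≤ ∫⁻ x in V', ‖z x - w x‖ₑ ∂μ := by
      rw [← lintegral_indicator hV'm]
      refine (setLIntegral_mono' hV.1.measurableSet fun x hx => ?_).trans
        (setLIntegral_le_lintegral V _)
      rcases lt_or_ge (depth Ω o x) (7 * c / 8) with h | h
      · have hx' : x ∈ V' := ⟨(min_le_left _ _).trans_lt (hsV x hx), h⟩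
        rw [indicator_of_mem hx', ← mul_sub]
        exact enorm_cutoff_mul_le _ _ _ _
      · rw [ramp_eq_one (by linarith) (by linarith)]
        simp
    refine hle.trans (hzL.le.trans (ENNReal.coe_le_coe.2 ?_))
    exact div_le_self zero_le le_self_add
  · have hT : ∫⁻ x in {x | c / 8 < depth Ω o x ∧ depth Ω o x < 7 * c / 8}, ‖z x‖ₑ ∂μ ≤
        (ε / (1 + K) : ℝ≥0) + ∫⁻ x in Ω, ‖w x‖ₑ ∂μ := by
      have hTV' : {x | c / 8 < depth Ω o x ∧ depth Ω o x < 7 * c / 8} ⊆ V' := fun x hx =>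
        ⟨(min_le_right _ _).trans_lt hx.1, hx.2⟩
      refine (lintegral_mono_set hTV').trans ?_
      have := lintegral_enorm_sub_le (μ := μ.restrict V') (f := z) (g := w) (h := fun _ => 0)
        (((hz.continuousOn hUo).mono (subset_closure.trans hV'U.2.2)).aemeasurable hV'm)
        (hw.mono_measure (Measure.restrict_mono hV'Ω le_rfl))
      simp only [sub_zero] at this
      exact this.trans (add_le_add hzL.le (lintegral_mono_set hV'Ω))
    refine (add_le_add hzg.le (mul_le_mul_right hT _)).trans (le_of_eq ?_)
    have e : ENNReal.ofReal (4 / c) = K := rfl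
    have e2 : ((ε / (1 + K) : ℝ≥0) : ℝ≥0∞) + K * (ε / (1 + K) : ℝ≥0) = ε := by
      rw [← ENNReal.coe_mul, ← ENNReal.coe_add, ENNReal.coe_inj]
      field_simp
    rw [e, mul_add, ← e2]
    ring

end

/-! ### Inner regularity of the total variation -/

section InnerRegularity

variable {X : Type*} [MetricSpace X] {Ω : Set X} {o : X}

/-- The dyadic scale `c / 2 ^ k`. -/
noncomputable def scale (c : ℝ) (k : ℕ) : ℝ := c / 2 ^ k

theorem scale_pos {c : ℝ} (hc : 0 < c) (k : ℕ) : 0 < scale c k := div_pos hc (by positivity)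

theorem scale_succ (c : ℝ) (k : ℕ) : scale c (k + 1) = scale c k / 2 := by
  rw [scale, scale, pow_succ, div_div]

theorem scale_antitone {c : ℝ} (hc : 0 < c) : Antitone (scale c) :=
  antitone_nat_of_succ_le fun k => by
    rw [scale_succ]
    exact half_le_self (scale_pos hc k).le

/-- The set of points with `a < depth < b`, where the upper bound is dropped if `k = 0`. -/
def piece (Ω : Set X) (o : X) (k : ℕ) (a b : ℝ) : Set X :=
  {x | a < depth Ω o x ∧ (k = 0 ∨ depth Ω o x < b)}

theorem isOpen_piece (k : ℕ) (a b : ℝ) : IsOpen (piece Ω o k a b) := by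
  by_cases hk : k = 0
  · simpa [piece, hk] using isOpen_lt_depth (Ω := Ω) (o := o) a
  · simpa [piece, hk] using isOpen_shell (Ω := Ω) (o := o) a b

theorem piece_subset (hΩ : IsOpen Ω) (hΩ' : Ωᶜ.Nonempty) {k : ℕ} {a b : ℝ} (ha : 0 < a) :
    piece Ω o k a b ⊆ Ω := fun _ hx => (depth_pos_iff hΩ hΩ').1 (ha.trans hx.1)

theorem compactlyInside_piece [ProperSpace X] {k : ℕ} {a b a' b' : ℝ} (ha : 0 < a) (ha' : a' < a)
    (hb : b < b') : CompactlyInside (piece Ω o k a b) (piece Ω o k a' b') := by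
  by_cases hk : k = 0
  · have : CompactlyInside {x | a < depth Ω o x} (piece Ω o k a' b') :=
      compactlyInside_lt_depth ha fun x hx => ⟨ha'.trans_le hx, Or.inl hk⟩
    simpa [piece, hk] using this
  · have : CompactlyInside {x | a < depth Ω o x ∧ depth Ω o x < b} (piece Ω o k a' b') :=
      compactlyInside_shell ha fun x h1 h2 => ⟨ha'.trans_le h1, Or.inr (h2.trans_lt hb)⟩
    simpa [piece, hk] using this

/-- The first `k` such that the point has depth greater than `scale c (k + 1)`. -/
noncomputable def level (Ω : Set X) (o : X) (c : ℝ) (x : X) : ℕ :=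
  sInf {k | scale c k / 2 < depth Ω o x}

theorem level_eq {c : ℝ} (hc : 0 < c) {x : X} {k : ℕ} (h1 : scale c k / 2 < depth Ω o x)
    (h2 : k = 0 ∨ depth Ω o x ≤ scale c k) : level Ω o c x = k := by
  refine le_antisymm (Nat.sInf_le h1) ?_
  rcases h2 with rfl | h2
  · exact Nat.zero_le _
  refine le_csInf ⟨k, h1⟩ fun j hj => ?_
  by_contra hjk
  have h3 := scale_antitone hc (Nat.succ_le_of_lt (not_le.1 hjk))
  rw [Nat.succ_eq_add_one, scale_succ] at h3
  exact absurd (h2.trans h3) (not_le.2 hj)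

theorem level_spec {c : ℝ} {x : X} (hx : 0 < depth Ω o x) :
    scale c (level Ω o c x) / 2 < depth Ω o x ∧
      (level Ω o c x = 0 ∨ depth Ω o x ≤ scale c (level Ω o c x)) := by
  have hne : {k | scale c k / 2 < depth Ω o x}.Nonempty := by
    obtain ⟨n, hn⟩ := pow_unbounded_of_one_lt (c / depth Ω o x) (one_lt_two (α := ℝ))
    refine ⟨n, show c / 2 ^ n / 2 < depth Ω o x from ?_⟩
    rw [div_lt_iff₀ hx] at hn
    rw [div_div, div_lt_iff₀ (by positivity)]
    nlinarith [pow_pos (zero_lt_two (α := ℝ)) n]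
  refine ⟨Nat.sInf_mem hne, ?_⟩
  by_contra hcon
  push Not at hcon
  obtain ⟨j, hj⟩ := Nat.exists_eq_succ_of_ne_zero hcon.1
  have h1 := hcon.2
  rw [hj, Nat.succ_eq_add_one, scale_succ] at h1
  have h2 : level Ω o c x ≤ j := Nat.sInf_le h1
  omega

/-- The weight of the transition between the pieces `k` and `k + 1`. -/
noncomputable def transition (Ω : Set X) (o : X) (c : ℝ) (k : ℕ) (x : X) : ℝ :=
  ramp (10 / 16 * scale c k) (14 / 16 * scale c k) (depth Ω o x)

/-- A sequence of functions on dyadic shells, joined to one function. -/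
noncomputable def join (Ω : Set X) (o : X) (c : ℝ) (v : ℕ → X → ℝ) (x : X) : ℝ :=
  transition Ω o c (level Ω o c x) x * v (level Ω o c x) x +
    (1 - transition Ω o c (level Ω o c x) x) * v (level Ω o c x + 1) x

variable {c : ℝ} {v : ℕ → X → ℝ}

theorem join_eq_transition (hc : 0 < c) {x : X} {k : ℕ} (h1 : scale c k / 2 < depth Ω o x)
    (h2 : k = 0 ∨ depth Ω o x ≤ scale c k) :
    join Ω o c v x =
      transition Ω o c k x * v k x + (1 - transition Ω o c k x) * v (k + 1) x := by
  rw [join, level_eq hc h1 h2]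

/-- Here either the level is `k` and the weight is 1, or the level is `k - 1` and the weight is 0.
-/
theorem join_eq (hc : 0 < c) {x : X} {k : ℕ}
    (hx : x ∈ piece Ω o k (14 / 16 * scale c k) (5 / 4 * scale c k)) :
    join Ω o c v x = v k x := by
  have hpos := scale_pos hc k
  by_cases h : k = 0 ∨ depth Ω o x ≤ scale c k
  · rw [join_eq_transition hc (by linarith [hx.1]) h, transition,
      ramp_eq_one (by linarith) hx.1.le]
    ring
  · push Not at h
    obtain ⟨j, rfl⟩ := Nat.exists_eq_succ_of_ne_zero h.1
    have h2 := hx.2.resolve_left h.1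
    have hs := scale_succ c j
    rw [Nat.succ_eq_add_one] at *
    -- The scale halves from `j` to `j + 1`, so the bound 5/4 of the smaller scale is exactly 10/16
    -- of the larger one, where the ramp starts.
    rw [join_eq_transition (k := j) hc (by linarith) (Or.inr (by linarith)), transition,
      ramp_eq_zero (by linarith) (by linarith)]
    ring

/-- Each point of `Ω` is in the region where two consecutive functions are joined or in the region
where only one of them matters. -/
theorem join_cases (hc : 0 < c) {x : X} (hx : 0 < depth Ω o x) : ∃ k,
    (9 / 16 * scale c k < depth Ω o x ∧ depth Ω o x < 15 / 16 * scale c k) ∨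
      x ∈ piece Ω o k (14 / 16 * scale c k) (5 / 4 * scale c k) := by
  obtain ⟨h1, h2⟩ := level_spec (c := c) hx
  set k := level Ω o c x
  have hpos := scale_pos hc k
  have hs := scale_succ c k
  rcases le_or_gt (depth Ω o x) (9 / 16 * scale c k) with h | h
  · exact ⟨k + 1, Or.inr ⟨by linarith, Or.inr (by linarith)⟩⟩
  rcases lt_or_ge (depth Ω o x) (15 / 16 * scale c k) with h' | h'
  · exact ⟨k, Or.inl ⟨h, h'⟩⟩
  · exact ⟨k, Or.inr ⟨by linarith, h2.imp_right fun h3 => by linarith⟩⟩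

/-- The pieces on which the joined functions live. -/
def dyadicPiece (Ω : Set X) (o : X) (c : ℝ) (k : ℕ) : Set X :=
  piece Ω o k (scale c k / 2) (2 * scale c k)

/-- The part of a piece in which the function living there contributes to the joined function. -/
def innerPiece (Ω : Set X) (o : X) (c : ℝ) (k : ℕ) : Set X :=
  piece Ω o k (9 / 16 * scale c k) (15 / 8 * scale c k)

theorem compactlyInside_innerPiece [ProperSpace X] (hc : 0 < c) (k : ℕ) :
    CompactlyInside (innerPiece Ω o c k) (dyadicPiece Ω o c k) := by
  have hpos := scale_pos hc k
  exact compactlyInside_piece (by linarith) (by linarith) (by linarith)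

theorem innerPiece_subset (hc : 0 < c) (k : ℕ) : innerPiece Ω o c k ⊆ dyadicPiece Ω o c k :=
  fun _ hx => ⟨by linarith [hx.1, scale_pos hc k],
    hx.2.imp_right fun h => by linarith [scale_pos hc k]⟩

/-- The region of transition between the pieces `k` and `k + 1`. -/
def transitionSet (Ω : Set X) (o : X) (c : ℝ) (k : ℕ) : Set X :=
  {x | 9 / 16 * scale c k < depth Ω o x ∧ depth Ω o x < 15 / 16 * scale c k}

theorem transitionSet_subset (hc : 0 < c) (k : ℕ) :
    transitionSet Ω o c k ⊆ innerPiece Ω o c k ∩ innerPiece Ω o c (k + 1) := by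
  have hpos := scale_pos hc k
  have hs := scale_succ c k
  exact fun x hx => ⟨⟨hx.1, Or.inr (by linarith [hx.2])⟩,
    ⟨by linarith [hx.1], Or.inr (by linarith [hx.2])⟩⟩

/-- The contribution of the transitions to the gradient of the joined function. -/
noncomputable def transitionGradient (Ω : Set X) (o : X) (c : ℝ) (v : ℕ → X → ℝ) (x : X) :
    ℝ≥0∞ :=
  ∑' k, (transitionSet Ω o c k).indicator
    (fun y => ENNReal.ofReal (4 / scale c k) * ‖v k y - v (k + 1) y‖ₑ) x

theorem locallyGlued_join (hΩ : IsOpen Ω) (hΩ' : Ωᶜ.Nonempty) (hc : 0 < c) {x : X} (hx : x ∈ Ω) :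
    LocallyGlued (dyadicPiece Ω o c) v (join Ω o c v) (transitionGradient Ω o c v) x := by
  obtain ⟨k, hk | hk⟩ := join_cases hc ((depth_pos_iff (o := o) hΩ hΩ').2 hx)
  · have hpos := scale_pos hc k
    refine ⟨transitionSet Ω o c k, shell_mem_nhds hk.1 hk.2, k, k + 1, fun y hy =>
      ⟨innerPiece_subset hc _ (transitionSet_subset hc k hy).1,
        innerPiece_subset hc _ (transitionSet_subset hc k hy).2⟩,
      transition Ω o c k, (4 / scale c k).toNNReal, ?_, fun y _ => ramp_mem _ _ _,
      fun y hy => ?_, fun y hy => ?_⟩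
    -- The ramp runs from 10/16 to 14/16 of the scale, a quarter of it.
    · refine (lipschitzWith_ramp_depth (by linarith) ?_).lipschitzOnWith
      rw [Real.coe_toNNReal _ (by positivity)]
      field_simp
      norm_num
    · exact join_eq_transition hc (by linarith [hy.1]) (Or.inr (by linarith [hy.2]))
    · refine le_trans (le_of_eq ?_) (ENNReal.le_tsum k)
      rw [indicator_of_mem hy, Real.coe_toNNReal _ (by positivity),
        ENNReal.ofReal_mul (by positivity), Real.enorm_eq_ofReal_abs]
  · have hpos := scale_pos hc k
    refine ⟨_, (isOpen_piece _ _ _).mem_nhds hk, k, k, fun y hy => ?_, fun _ => 1, 0,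
      (LipschitzWith.const' _).lipschitzOnWith, fun y _ => by simp, fun y hy => ?_, by simp⟩
    · have : y ∈ dyadicPiece Ω o c k :=
        ⟨by linarith [hy.1], hy.2.imp_right fun h => by linarith⟩
      exact ⟨this, this⟩
    · rw [join_eq hc hy]
      ring

theorem enorm_join_sub_le (hΩ : IsOpen Ω) (hΩ' : Ωᶜ.Nonempty) (hc : 0 < c) (u : X → ℝ) {x : X}
    (hx : x ∈ Ω) : ‖join Ω o c v x - u x‖ₑ ≤
      ∑' k, (innerPiece Ω o c k).indicator (fun y => ‖v k y - u y‖ₑ) x := by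
  have hle : ∀ k, x ∈ innerPiece Ω o c k → ENNReal.ofReal |v k x - u x| ≤
      ∑' k, (innerPiece Ω o c k).indicator (fun y => ‖v k y - u y‖ₑ) x := fun k hk => by
    refine le_trans (le_of_eq ?_) (ENNReal.le_tsum k)
    rw [indicator_of_mem hk, Real.enorm_eq_ofReal_abs]
  rw [Real.enorm_eq_ofReal_abs]
  obtain ⟨k, hk | hk⟩ := join_cases hc ((depth_pos_iff (o := o) hΩ hΩ').2 hx)
  · have hpos := scale_pos hc k
    have hk' := transitionSet_subset hc k hk
    rw [join_eq_transition (k := k) hc (by linarith [hk.1]) (Or.inr (by linarith [hk.2]))]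
    have hmem : transition Ω o c k x ∈ Icc (0 : ℝ) 1 := ramp_mem _ _ _
    -- Writing `u x` as a combination of itself with the same weight makes the weight increment
    -- vanish.
    have := ofReal_abs_convexCombination_sub_le (p' := transition Ω o c k x) hmem
      (hle k hk'.1) (hle (k + 1) hk'.2)
    rw [sub_self, abs_zero, zero_mul, ENNReal.ofReal_zero, add_zero] at this
    convert this using 4
    ring
  · have hpos := scale_pos hc k
    rw [join_eq hc hk]
    exact hle k ⟨by linarith [hk.1], hk.2.imp_right fun h => by linarith⟩

theorem scale_scale (m k : ℕ) : scale (scale c m) k = scale c (k + m) := by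
  rw [scale, scale, scale, div_div, ← pow_add, add_comm]

theorem dyadicPiece_zero (m : ℕ) :
    dyadicPiece Ω o (scale c m) 0 = {x | scale c (m + 1) < depth Ω o x} := by
  ext x
  simp [dyadicPiece, piece, scale_scale, scale_succ]

theorem dyadicPiece_succ (m k : ℕ) : dyadicPiece Ω o (scale c m) (k + 1) =
    {x | scale c (k + m + 2) < depth Ω o x ∧ depth Ω o x < scale c (k + m)} := by
  have h1 : scale (scale c m) (k + 1) / 2 = scale c (k + m + 2) := by
    rw [scale_scale, ← scale_succ, Nat.add_right_comm k 1 m]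
  have h2 : 2 * scale (scale c m) (k + 1) = scale c (k + m) := by
    rw [scale_scale, Nat.add_right_comm k 1 m, scale_succ, mul_div_cancel₀ _ two_ne_zero]
  rw [dyadicPiece, h1, h2]
  ext x
  simp [piece]

variable [MeasurableSpace X] [BorelSpace X] {μ : Measure X}

/-- Consecutive shells overlap, but the shell with index `n` is disjoint from {depth > scale c n}.
Superadditivity therefore telescopes in steps of two, which leaves the two terms `M N + M (N + 1)`.
-/
theorem tsum_totalVariation_shell_ne_top (hΩ : IsOpen Ω) (hΩ' : Ωᶜ.Nonempty) (hc : 0 < c)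
    {u : X → ℝ} (hfin : totalVariation μ u Ω ≠ ∞) :
    ∑' n, totalVariation μ u
      {x | scale c (n + 2) < depth Ω o x ∧ depth Ω o x < scale c n} ≠ ∞ := by
  set M : ℕ → ℝ≥0∞ := fun n => totalVariation μ u {x | scale c n < depth Ω o x} with hM
  have hMq : ∀ n, M n + totalVariation μ u
      {x | scale c (n + 2) < depth Ω o x ∧ depth Ω o x < scale c n} ≤ M (n + 2) := fun n => by
    refine totalVariation_add_le (isOpen_lt_depth _) ?_ (fun x hx => ?_) (fun x hx => hx.1) u
    · exact disjoint_left.2 fun x hx hx' => lt_asymm (show scale c n < depth Ω o x from hx) hx'.2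
    · exact (scale_antitone hc (Nat.le_add_right n 2)).trans_lt hx
  have hpart : ∀ N, ∑ n ∈ Finset.range N, totalVariation μ u
      {x | scale c (n + 2) < depth Ω o x ∧ depth Ω o x < scale c n} ≤ M N + M (N + 1) := by
    intro N
    induction N with
    | zero => exact (Finset.sum_range_zero _).trans_le zero_le
    | succ N ih =>
      rw [Finset.sum_range_succ]
      refine (add_le_add ih le_rfl).trans ?_
      rw [add_right_comm, add_comm]
      exact add_le_add le_rfl (hMq N)
  have hMle : ∀ n, M n ≤ totalVariation μ u Ω := fun n =>
    totalVariation_mono (isOpen_lt_depth _) fun x hx =>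
      (depth_pos_iff hΩ hΩ').1 ((scale_pos hc n).trans hx)
  refine ne_top_of_le_ne_top (ENNReal.add_ne_top.2 ⟨hfin, hfin⟩) ?_
  rw [ENNReal.tsum_eq_iSup_nat]
  exact iSup_le fun N => (hpart N).trans (add_le_add (hMle _) (hMle _))

variable [ProperSpace X]

/-- The total variation is at most the sum of the total variations in dyadic shells. -/
theorem totalVariation_le_tsum (hΩ : IsOpen Ω) (hΩ' : Ωᶜ.Nonempty) (hc : 0 < c) {u : X → ℝ}
    (hu : AEMeasurable u (μ.restrict Ω)) :
    totalVariation μ u Ω ≤ ∑' k, totalVariation μ u (dyadicPiece Ω o c k) := by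
  rcases eq_or_ne (∑' k, totalVariation μ u (dyadicPiece Ω o c k)) ∞ with hfin | hfin
  · rw [hfin]
    exact le_top
  refine totalVariation_le hΩ hΩ' fun V hV ε hε => ?_
  -- Three thirds of `ε`: one for the gradients of the approximants, two for the transitions, each
  -- of which involves two neighbours.
  obtain ⟨δ, hδ, hsum⟩ := ENNReal.exists_pos_sum_of_countable
    (ENNReal.div_pos (ENNReal.coe_ne_zero.2 hε.ne') (ENNReal.ofNat_ne_top (n := 3))).ne' ℕ
  set K : ℕ → ℝ≥0 := fun k => (4 / scale c k).toNNReal with hK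
  -- In transition `k` the error of `v (k + 1)` is weighted by `K k`, while its smallness is tuned
  -- to `K (k + 1)`.
  have hKmono : ∀ k, K k ≤ K (k + 1) := fun k => Real.toNNReal_le_toNNReal
    (div_le_div_of_nonneg_left (by norm_num) (scale_pos hc _) (scale_antitone hc k.le_succ))
  -- Small enough for both the L¹ distance and its multiple by the slope of the weight.
  set η : ℕ → ℝ≥0 := fun k => δ k / (1 + K k) with hη
  have hηpos : ∀ k, (0 : ℝ≥0∞) < η k := fun k =>
    ENNReal.coe_pos.2 (div_pos (hδ k) (by positivity))
  have hηδ : ∀ k, (η k : ℝ≥0∞) ≤ δ k := fun k =>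
    ENNReal.coe_le_coe.2 (div_le_self zero_le le_self_add)
  have hKη : ∀ k, (K k * η k : ℝ≥0∞) ≤ δ k := fun k => by
    rw [← ENNReal.coe_mul, ENNReal.coe_le_coe]
    simp only [hη]
    rw [mul_div_assoc', div_le_iff₀ (by positivity), mul_comm]
    exact mul_le_mul_right le_add_self _
  have hS : ∀ k, IsOpen (dyadicPiece Ω o c k) := fun k => isOpen_piece _ _ _
  have hSΩ : ∀ k, dyadicPiece Ω o c k ⊆ Ω := fun k =>
    piece_subset hΩ hΩ' (half_pos (scale_pos hc k))
  have hZm : ∀ k, MeasurableSet (innerPiece Ω o c k) := fun k => (isOpen_piece _ _ _).measurableSet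
  have hTm : ∀ k, MeasurableSet (transitionSet Ω o c k) := fun k => (isOpen_shell _ _).measurableSet
  have hZS : ∀ k, innerPiece Ω o c k ⊆ dyadicPiece Ω o c k := innerPiece_subset hc
  have hZΩ : ∀ k, innerPiece Ω o c k ⊆ Ω := fun k => (hZS k).trans (hSΩ k)
  have hTZ : ∀ k, transitionSet Ω o c k ⊆ innerPiece Ω o c k := fun k x hx =>
    (transitionSet_subset hc k hx).1
  have hTZ' : ∀ k, transitionSet Ω o c k ⊆ innerPiece Ω o c (k + 1) := fun k x hx =>
    (transitionSet_subset hc k hx).2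
  have happ := fun k => exists_approx (ENNReal.lt_add_right
    (ne_top_of_le_ne_top hfin (ENNReal.le_tsum k)) (ENNReal.coe_ne_zero.2 (hδ k).ne'))
    (compactlyInside_innerPiece (Ω := Ω) (o := o) hc k) (hηpos k)
  choose v hv hvL hvg using happ
  have hvlip : ∀ k, LocallyLipschitzOn (dyadicPiece Ω o c k) (v k) := fun k =>
    (isLipLoc_iff (hS k)).1 (hv k)
  have hvm : ∀ k {Z : Set X}, MeasurableSet Z → Z ⊆ dyadicPiece Ω o c k →
      AEMeasurable (v k) (μ.restrict Z) := fun k Z hZ hsub =>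
    ((hvlip k).continuousOn.mono hsub).aemeasurable hZ
  have hum : ∀ {Z : Set X}, Z ⊆ Ω → AEMeasurable u (μ.restrict Z) := fun hZ =>
    hu.mono_measure (Measure.restrict_mono hZ le_rfl)
  have hGm : ∀ k, AEMeasurable ((transitionSet Ω o c k).indicator
      (fun y => ENNReal.ofReal (4 / scale c k) * ‖v k y - v (k + 1) y‖ₑ)) (μ.restrict Ω) := by
    intro k
    refine (aemeasurable_indicator_iff (hTm k)).2 ?_
    rw [Measure.restrict_restrict_of_subset ((hTZ k).trans (hZΩ k))]
    exact ((hvm k (hTm k) ((hTZ k).trans (hZS k))).sub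
      (hvm (k + 1) (hTm k) ((hTZ' k).trans (hZS _)))).enorm.const_mul _
  have hHm : AEMeasurable (transitionGradient Ω o c v) (μ.restrict Ω) := AEMeasurable.tsum hGm
  refine ⟨join Ω o c v, (isLipLoc_iff hΩ).2 fun x hx => ?_, ?_, ?_⟩
  · obtain ⟨L, t, ht, hL⟩ :=
      (locallyGlued_join (o := o) (v := v) hΩ hΩ' hc hx).exists_lipschitzOnWith hvlip
    exact ⟨L, t, mem_nhdsWithin_of_mem_nhds ht, hL⟩
  · refine (lintegral_mono_set (subset_closure.trans hV.2.2)).trans ?_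
    refine (setLIntegral_mono' hΩ.measurableSet fun x hx => enorm_join_sub_le (o := o) hΩ hΩ' hc u
      hx).trans ?_
    rw [lintegral_tsum fun k => ?_]
    · refine le_trans (ENNReal.tsum_le_tsum fun k => ?_) (hsum.le.trans ?_)
      · rw [lintegral_indicator (hZm k), Measure.restrict_restrict_of_subset (hZΩ k)]
        exact (hvL k).le.trans (hηδ k)
      · exact ENNReal.div_le_of_le_mul (le_mul_of_one_le_right' (by norm_num))
    · refine (aemeasurable_indicator_iff (hZm k)).2 ?_
      rw [Measure.restrict_restrict_of_subset (hZΩ k)]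
      exact ((hvm k (hZm k) (hZS k)).sub (hum (hZΩ k))).enorm
  · have hT : ∀ k, ∫⁻ x in Ω, (transitionSet Ω o c k).indicator
        (fun y => ENNReal.ofReal (4 / scale c k) * ‖v k y - v (k + 1) y‖ₑ) x ∂μ ≤
        δ k + δ (k + 1) := by
      intro k
      rw [lintegral_indicator (hTm k),
        Measure.restrict_restrict_of_subset ((hTZ k).trans (hZΩ k)),
        lintegral_const_mul' _ _ ENNReal.ofReal_ne_top]
      have h1 : ∫⁻ x in transitionSet Ω o c k, ‖v k x - v (k + 1) x‖ₑ ∂μ ≤ η k + η (k + 1) := by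
        refine (lintegral_enorm_sub_le (hvm k (hTm k) ((hTZ k).trans (hZS k)))
          (hum ((hTZ k).trans (hZΩ k)))).trans (add_le_add ?_ ?_)
        · exact (lintegral_mono_set (hTZ k)).trans (hvL k).le
        · simp only [enorm_sub_rev (u _)]
          exact (lintegral_mono_set (hTZ' k)).trans (hvL (k + 1)).le
      refine (mul_le_mul_right h1 _).trans ?_
      rw [mul_add]
      refine add_le_add (hKη k) (le_trans (mul_le_mul_left ?_ _) (hKη (k + 1)))
      exact ENNReal.coe_le_coe.2 (hKmono k)
    refine (gradientIntegral_glued_le (fun k => (hS k).measurableSet) hSΩ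
      (fun k => (hvlip k).continuousOn) hHm
      fun x hx => locallyGlued_join hΩ hΩ' hc hx).trans ?_
    have h1 := ENNReal.tsum_le_tsum fun k => (hvg k).le
    rw [ENNReal.tsum_add] at h1
    have h2 : ∫⁻ x in Ω, transitionGradient Ω o c v x ∂μ ≤ (∑' k, (δ k : ℝ≥0∞)) + ∑' k, (δ k : ℝ≥0∞) := by
      simp only [transitionGradient]
      rw [lintegral_tsum hGm]
      refine (ENNReal.tsum_le_tsum hT).trans ?_
      rw [ENNReal.tsum_add]
      exact add_le_add le_rfl (ENNReal.tsum_comp_le_tsum_of_injective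
        (add_left_injective 1) fun k => (δ k : ℝ≥0∞))
    refine (add_le_add h1 h2).trans ?_
    rw [add_assoc]
    refine add_le_add le_rfl ?_
    calc (∑' k, (δ k : ℝ≥0∞)) + ((∑' k, (δ k : ℝ≥0∞)) + ∑' k, (δ k : ℝ≥0∞))
        ≤ ε / 3 + (ε / 3 + ε / 3) := add_le_add hsum.le (add_le_add hsum.le hsum.le)
      _ = ε := by rw [← add_assoc, ENNReal.add_thirds]

/-- Inner regularity of the total variation. -/
theorem exists_totalVariation_le_add (hΩ : IsOpen Ω) (hΩ' : Ωᶜ.Nonempty) {u : X → ℝ}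
    (hu : AEMeasurable u (μ.restrict Ω)) (hfin : totalVariation μ u Ω ≠ ∞) {ε : ℝ≥0∞}
    (hε : 0 < ε) : ∃ c > 0, totalVariation μ u Ω ≤
      totalVariation μ u {x | c < depth Ω o x} + ε := by
  have hlim := ENNReal.tendsto_sum_nat_add _
    (tsum_totalVariation_shell_ne_top (o := o) hΩ hΩ' one_pos hfin)
  -- Starting the dyadic scales at index `m`, the unbounded piece is a superlevel set of `depth` and
  -- the remaining pieces are a tail of the convergent series.
  obtain ⟨m, hm⟩ := (hlim.eventually_lt_const hε).exists
  have hle := totalVariation_le_tsum (o := o) hΩ hΩ' (scale_pos one_pos m) hu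
  rw [tsum_eq_zero_add' ENNReal.summable, dyadicPiece_zero] at hle
  simp only [dyadicPiece_succ] at hle
  exact ⟨scale 1 (m + 1), scale_pos one_pos _, hle.trans (add_le_add le_rfl hm.le)⟩

end InnerRegularity

/-! ### Traces and strict convergence -/

section StrictConvergence

variable {X : Type*} [MetricSpace X] {Ω : Set X} {o : X}

theorem depth_eq_zero_of_mem_frontier (hΩ : IsOpen Ω) (hΩ' : Ωᶜ.Nonempty) {x : X}
    (hx : x ∈ frontier Ω) : depth Ω o x = 0 := by
  rw [hΩ.frontier_eq] at hx
  exact le_antisymm (not_lt.1 fun h => hx.2 ((depth_pos_iff hΩ hΩ').1 h)) depth_nonneg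

variable [MeasurableSpace X] [BorelSpace X] {μ : Measure X}

theorem hasInteriorTraceAt_congr (hΩ : IsOpen Ω) {w w' : X → ℝ} {x : X} {r : ℝ} (hr : 0 < r)
    (h : ∀ y ∈ Ω ∩ Metric.ball x r, w y = w' y) (t : ℝ) :
    HasInteriorTraceAt μ Ω w x t ↔ HasInteriorTraceAt μ Ω w' x t := by
  refine tendsto_congr' ?_
  filter_upwards [Ioo_mem_nhdsGT hr] with s hs
  rw [setLAverage_eq, setLAverage_eq]
  congr 1
  refine setLIntegral_congr_fun (hΩ.measurableSet.inter measurableSet_ball) fun y hy => ?_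
  simp only [h y ⟨hy.1, Metric.ball_subset_ball hs.2.le hy.2⟩]

/-- Cutting off away from the boundary does not change the interior trace. -/
theorem interiorTrace_cutoff (hΩ : IsOpen Ω) (hΩ' : Ωᶜ.Nonempty) {c : ℝ} (hc : 0 < c)
    (w : X → ℝ) {x : X} (hx : x ∈ frontier Ω) :
    interiorTrace μ Ω (fun y => (1 - ramp (c / 4) (c / 2) (depth Ω o y)) * w y) x =
      interiorTrace μ Ω w x := by
  rw [interiorTrace, interiorTrace]
  -- Both traces are chosen by `Classical.epsilon`, so equal predicates give equal values even where
  -- no trace exists.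
  congr 1
  funext t
  refine propext (hasInteriorTraceAt_congr hΩ (show 0 < c / 4 by positivity) (fun y hy => ?_) t)
  have h1 := (lipschitzWith_depth (U := Ω) (o := o)).dist_le_mul y x
  rw [depth_eq_zero_of_mem_frontier hΩ hΩ' hx, Real.dist_eq, sub_zero, NNReal.coe_one,
    one_mul] at h1
  have h2 := hy.2
  rw [Metric.mem_ball] at h2
  rw [ramp_eq_zero (by linarith) (by linarith [le_abs_self (depth Ω o y)]), sub_zero, one_mul]

theorem integrableOn_cutoff {a b : ℝ} {K : ℝ≥0} (hab : a < b)
    (hK : 1 ≤ K * (b - a)) {w : X → ℝ} (hw : IntegrableOn w Ω μ) :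
    IntegrableOn (fun x => (1 - ramp a b (depth Ω o x)) * w x) Ω μ := by
  have hcont : Continuous fun x => 1 - ramp a b (depth Ω o x) :=
    continuous_const.sub (lipschitzWith_ramp_depth hab hK).continuous
  refine ⟨?_, (lintegral_mono fun x => enorm_cutoff_mul_le a b (depth Ω o x) (w x)).trans_lt
    hw.2⟩
  exact (hcont.measurable.aemeasurable.mul hw.1.aemeasurable).aestronglyMeasurable

variable [ProperSpace X]

/-- The trace is controlled by the behaviour of the function near the boundary. -/
theorem lintegral_trace_le (hΩ : IsOpen Ω) (hΩ' : Ωᶜ.Nonempty) {C : ℝ≥0}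
    (hC : ∀ u : X → ℝ, IsBV μ u Ω →
      ∫⁻ x in frontier Ω, ‖interiorTrace μ Ω u x‖ₑ ∂hausdorffCodimOne μ ≤ C * bvNorm μ u Ω)
    {c : ℝ} (hc : 0 < c) {w : X → ℝ} (hw : IsBV μ w Ω) :
    ∫⁻ x in frontier Ω, ‖interiorTrace μ Ω w x‖ₑ ∂hausdorffCodimOne μ ≤
      C * ((1 + ENNReal.ofReal (4 / c)) * (∫⁻ x in Ω, ‖w x‖ₑ ∂μ) +
        totalVariation μ w {x | 0 < depth Ω o x ∧ depth Ω o x < c}) := by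
  have h1 := totalVariation_cutoff_le (o := o) hΩ hΩ' hc hw.1.1.aemeasurable
  have hUfin : totalVariation μ w {x | 0 < depth Ω o x ∧ depth Ω o x < c} < ∞ :=
    (totalVariation_mono (isOpen_shell _ _) fun x hx =>
      (depth_pos_iff hΩ hΩ').1 hx.1).trans_lt hw.2
  have hBV : IsBV μ (fun x => (1 - ramp (c / 4) (c / 2) (depth Ω o x)) * w x) Ω := by
    refine ⟨integrableOn_cutoff (K := (4 / c).toNNReal) (by linarith) ?_ hw.1,
      h1.trans_lt (ENNReal.add_lt_top.2 ⟨hUfin, ENNReal.mul_lt_top ENNReal.ofReal_lt_top hw.1.2⟩)⟩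
    rw [Real.coe_toNNReal _ (by positivity)]
    field_simp
    norm_num
  calc ∫⁻ x in frontier Ω, ‖interiorTrace μ Ω w x‖ₑ ∂hausdorffCodimOne μ
      = ∫⁻ x in frontier Ω, ‖interiorTrace μ Ω (fun x =>
          (1 - ramp (c / 4) (c / 2) (depth Ω o x)) * w x) x‖ₑ ∂hausdorffCodimOne μ :=
        setLIntegral_congr_fun isClosed_frontier.measurableSet fun x hx => by
          simp only [interiorTrace_cutoff hΩ hΩ' hc w hx]
    _ ≤ _ := hC _ hBV
    _ ≤ _ := by
        refine mul_le_mul_right ?_ _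
        refine (add_le_add (lintegral_mono fun x => enorm_cutoff_mul_le _ _ _ _) h1).trans
          (le_of_eq ?_)
        ring

theorem IsBV.sub (hΩ : IsOpen Ω) (hΩ' : Ωᶜ.Nonempty) {u u' : X → ℝ} (hu : IsBV μ u Ω)
    (hu' : IsBV μ u' Ω) : IsBV μ (fun x => u x - u' x) Ω :=
  ⟨hu.1.sub hu'.1, (totalVariation_sub_le hΩ hΩ' hu.1.1.aemeasurable).trans_lt
    (ENNReal.add_lt_top.2 ⟨hu.2, hu'.2⟩)⟩

/-- Under strict convergence no variation concentrates at the boundary. -/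
theorem eventually_totalVariation_shell_le (hΩ : IsOpen Ω) (hΩ' : Ωᶜ.Nonempty) {u : X → ℝ}
    (hu : IsBV μ u Ω) {v : ℕ → X → ℝ} (hv : ∀ k, IsBV μ (v k) Ω)
    (hL1 : Tendsto (fun k => ∫⁻ x in Ω, ‖v k x - u x‖ₑ ∂μ) atTop (𝓝 0))
    (hstrict : Tendsto (fun k => totalVariation μ (v k) Ω) atTop (𝓝 (totalVariation μ u Ω)))
    {δ : ℝ≥0∞} (hδ : 0 < δ) : ∃ c > 0, ∀ᶠ k in atTop,
      totalVariation μ (fun x => v k x - u x) {x | 0 < depth Ω o x ∧ depth Ω o x < c} ≤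
        4 * δ := by
  obtain ⟨c, hc, hreg⟩ := exists_totalVariation_le_add (o := o) hΩ hΩ' hu.1.1.aemeasurable
    hu.2.ne hδ
  set A := {x | c < depth Ω o x} with hA
  set U := {x | 0 < depth Ω o x ∧ depth Ω o x < c} with hU
  have hAo : IsOpen A := isOpen_lt_depth c
  have hUo : IsOpen U := isOpen_shell 0 c
  have hAΩ : A ⊆ Ω := fun x hx => (depth_pos_iff hΩ hΩ').1 (hc.trans hx)
  have hUΩ : U ⊆ Ω := fun x hx => (depth_pos_iff hΩ hΩ').1 hx.1
  have hAU : Disjoint A U := disjoint_left.2 fun x hx hx' =>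
    lt_asymm (show c < depth Ω o x from hx) hx'.2
  have hAfin : ∀ {w : X → ℝ}, IsBV μ w Ω → totalVariation μ w A ≠ ∞ := fun hw =>
    ((totalVariation_mono hAo hAΩ).trans_lt hw.2).ne
  have hsplit : ∀ w : X → ℝ, totalVariation μ w A + totalVariation μ w U ≤
      totalVariation μ w Ω := totalVariation_add_le hAo hAU hAΩ hUΩ
  -- Superadditivity over `A` and `U`, with the finite variation in `A` cancelled.
  have huU : totalVariation μ u U ≤ δ :=
    (ENNReal.add_le_add_iff_left (hAfin hu)).1 ((hsplit u).trans hreg)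
  have hlsc : ∀ᶠ k in atTop, totalVariation μ u A ≤ totalVariation μ (v k) A + δ := by
    by_contra hcon
    rw [not_eventually] at hcon
    simp only [not_le] at hcon
    obtain ⟨k, hk⟩ := hcon.exists
    -- If infinitely many `v k` lost more than `δ` of variation in `A`, lower semicontinuity would
    -- pass the loss on to `u` itself.
    have h1 : totalVariation μ u A ≤ totalVariation μ u A - δ :=
      totalVariation_le_of_frequently hAo (hΩ'.mono (compl_subset_compl.2 hAΩ))
        (fun k => (hv k).1.1.aemeasurable.mono_measure (Measure.restrict_mono hAΩ le_rfl))
        (tendsto_of_tendsto_of_tendsto_of_le_of_le tendsto_const_nhds hL1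
          (fun _ => zero_le) fun _ => lintegral_mono_set hAΩ)
        (hcon.mono fun k hk => ENNReal.le_sub_of_add_le_right
          (ne_top_of_lt ((le_add_self).trans_lt hk)) hk.le)
    exact absurd h1 (not_le.2 (ENNReal.sub_lt_self (hAfin hu)
      (zero_le.trans_lt hk).ne' hδ.ne'))
  have hlim : ∀ᶠ k in atTop, totalVariation μ (v k) Ω ≤ totalVariation μ u Ω + δ :=
    (hstrict.eventually_lt_const (ENNReal.lt_add_right hu.2.ne hδ.ne')).mono fun _ h => h.le
  refine ⟨c, hc, (hlsc.and hlim).mono fun k hk => ?_⟩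
  -- One `δ` each for strict convergence, inner regularity and lower semicontinuity.
  have h3 : totalVariation μ (v k) U ≤ δ + δ + δ := by
    refine (ENNReal.add_le_add_iff_left (hAfin (hv k))).1 ?_
    calc _ ≤ totalVariation μ u Ω + δ := (hsplit (v k)).trans hk.2
      _ ≤ totalVariation μ u A + δ + δ := add_le_add hreg le_rfl
      _ ≤ totalVariation μ (v k) A + δ + δ + δ := by gcongr; exact hk.1
      _ = _ := by ring
  calc _ ≤ totalVariation μ (v k) U + totalVariation μ u U :=
        totalVariation_sub_le hUo (hΩ'.mono (compl_subset_compl.2 hUΩ))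
          ((hv k).1.1.aemeasurable.mono_measure (Measure.restrict_mono hUΩ le_rfl))
    _ ≤ δ + δ + δ + δ := add_le_add h3 huU
    _ = _ := by ring

end StrictConvergence

end BVTrace

theorem mainTheorem11 {X : Type*} [MetricSpace X] [CompleteSpace X] [Nontrivial X]
    [MeasurableSpace X] [BorelSpace X] (μ : Measure X)
    (hdoubling : BVTrace.IsDoubling μ) (hpoincare : BVTrace.SupportsPoincare μ)
    (Ω : Set X) (hΩ : IsOpen Ω) (htrace : BVTrace.TraceOperatorIsLinearBounded μ Ω)
    (u : X → ℝ) (hu : BVTrace.IsBV μ u Ω)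
    (v : ℕ → X → ℝ) (hv : ∀ k, BVTrace.IsBV μ (v k) Ω)
    (hL1 : Tendsto (fun k => ∫⁻ x in Ω, ‖v k x - u x‖ₑ ∂μ) atTop (𝓝 0))
    (hstrict : Tendsto (fun k => BVTrace.totalVariation μ (v k) Ω) atTop
      (𝓝 (BVTrace.totalVariation μ u Ω))) :
    Tendsto
      (fun k => ∫⁻ x in frontier Ω,
        ‖BVTrace.interiorTrace μ Ω (v k) x - BVTrace.interiorTrace μ Ω u x‖ₑ
          ∂BVTrace.hausdorffCodimOne μ)
      atTop (𝓝 0) := by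
  have := hdoubling.properSpace
  obtain ⟨C, hC⟩ := htrace.bounded
  rcases Ωᶜ.eq_empty_or_nonempty with hΩ' | hΩ'
  -- If Ω is the whole space there is no boundary; otherwise a point of the complement serves as
  -- base point of `depth`.
  · rw [compl_empty_iff.1 hΩ', frontier_univ]
    simp
  obtain ⟨o, -⟩ := id hΩ'
  have heq : ∀ k, ∫⁻ x in frontier Ω,
      ‖BVTrace.interiorTrace μ Ω (v k) x - BVTrace.interiorTrace μ Ω u x‖ₑ
        ∂BVTrace.hausdorffCodimOne μ =
      ∫⁻ x in frontier Ω, ‖BVTrace.interiorTrace μ Ω (fun x => v k x - u x) x‖ₑ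
        ∂BVTrace.hausdorffCodimOne μ := by
    intro k
    refine lintegral_congr_ae ((htrace.linear (v k) u (hv k) hu 1 (-1)).mono fun x hx => ?_)
    simp only [one_mul, neg_one_mul, ← sub_eq_add_neg] at hx
    simp only [hx]
  simp only [heq]
  refine ENNReal.tendsto_nhds_zero.2 fun ε hε => ?_
  -- The factor 5 is one `δ` for the L¹ term and four for the variation in the layer.
  obtain ⟨δ, hδ, hδε⟩ := ENNReal.exists_nnreal_pos_mul_lt
    (ENNReal.mul_ne_top (ENNReal.coe_ne_top (r := C)) (ENNReal.ofNat_ne_top (n := 5))) hε.ne'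
  have hδ' : (0 : ℝ≥0∞) < δ := ENNReal.coe_pos.2 hδ
  obtain ⟨c, hc, hev⟩ := BVTrace.eventually_totalVariation_shell_le (o := o) hΩ hΩ' hu hv hL1
    hstrict hδ'
  have hsmall : Tendsto (fun k => (1 + ENNReal.ofReal (4 / c)) * ∫⁻ x in Ω, ‖v k x - u x‖ₑ ∂μ)
      atTop (𝓝 0) := by
    have := ENNReal.Tendsto.const_mul (a := 1 + ENNReal.ofReal (4 / c)) hL1
      (Or.inr (by finiteness))
    rwa [mul_zero] at this
  filter_upwards [hev, hsmall.eventually_lt_const hδ'] with k hk1 hk2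
  refine (BVTrace.lintegral_trace_le (o := o) hΩ hΩ' hC hc ((hv k).sub hΩ hΩ' hu)).trans ?_
  refine (mul_le_mul_right (add_le_add hk2.le hk1) _).trans (le_trans (le_of_eq ?_) hδε.le)
  ring
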